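/- Let $\mathbf F$ be a field and work with $\mathbf Z$-graded dg-modules over $\mathbf F$ (with Koszul signs). Let $\mathcal E$ be the differential graded Barratt–Eccles operad: $\mathcal E(r)$ is the normalized chain complex of the simplicial set $\mathcal W(r)$ whose $n$-simplices are the tuples $(w_0,\dots,w_n)$ of permutations $w_i\in\Sigma_r$, with the diagonal left action of $\Sigma_r$, the composition product induced by the substitution of permutations and the Eilenberg–Zilber shuffle map, and the diagonal $\Delta(w_0,\dots,w_n)=\sum_{k=0}^n (w_0,\dots,w_k)\otimes(w_k,\dots,w_n)$. An $\mathcal E$-algebra is a dg-module $A$ with evaluation products $\mathcal E(r)\otimes A^{\otimes r}\to A$, and an $\mathcal E$-coalgebra is a dg-module $K$ with coproducts $\mathcal E(r)\otimes K\to K^{\otimes r}$, $\rho\otimes c\mapsto\rho^*(c)$; these are morphisms of dg-modules compatible with the operad unit, the composition products and the symmetric group actions. Let $K$ be an $\mathcal E$-coalgebra. For every $\mathcal E$-algebra $A$, the dg-module of homogeneous morphisms $\mathrm{Hom}_{\mathbf F}(K,A)$ is an $\mathcal E$-algebra with the operations $$\rho(u_1,\dots,u_r)=\sum_i \pm\,\rho^i_{(1)}\cdot(u_1\otimes\cdots\otimes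 u_r)\cdot(\rho^i_{(2)})^*,\qquad \Delta(\rho)=\sum_i\rho^i_{(1)}\otimes\rho^i_{(2)},$$ and the functor $\mathrm{Hom}_{\mathbf F}(K,-)$ from the category of $\mathcal E$-algebras to itself has a left adjoint $A\mapsto A\oslash K$. More explicitly, for every $\mathcal E$-algebra $A$ there is an $\mathcal E$-algebra $A\oslash K$ with a natural bijection $$\mathrm{Hom}_{\mathcal E}(A\oslash K,-)\cong\mathrm{Hom}_{\mathcal E}(A,\mathrm{Hom}_{\mathbf F}(K,-)),$$ where $\mathrm{Hom}_{\mathcal E}$ denotes the set of morphisms of $\mathcal E$-algebras. -/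

import Mathlib

open CategoryTheory
open scoped TensorProduct DirectSum

universe u

noncomputable section

namespace BarrattEccles

/-! ### The dg-operad of Barratt and Eccles -/

/-- The `n`-simplices `(w_0, ..., w_n)` of the simplicial set `W(r)`. A permutation `w` is read as
the word `w(1) w(2) ... w(r)`. -/
abbrev Simplex (r n : ℕ) : Type := Fin (n + 1) → Equiv.Perm (Fin r)

/-- A simplex is nondegenerate when consecutive vertices differ. -/
def Simplex.Nondegenerate {r n : ℕ} (x : Simplex r n) : Prop :=
  ∀ j : Fin n, x j.castSucc ≠ x j.succ

instance {r n : ℕ} : DecidablePred (Simplex.Nondegenerate (r := r) (n := n)) :=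
  fun x => inferInstanceAs (Decidable (∀ j : Fin n, x j.castSucc ≠ x j.succ))

/-- The nondegenerate `n`-simplices of `W(r)`. -/
abbrev NSimplex (r n : ℕ) : Type := {x : Simplex r n // x.Nondegenerate}

/-- The degree `n` part of `E(r)`: the normalized chains of `W(r)`, with the nondegenerate
simplices as basis. The lower degree `n` is the upper degree `-n`. -/
abbrev E (F : Type u) [Field F] (r n : ℕ) : Type u := NSimplex r n →₀ F

section Operad

variable {F : Type u} [Field F]

/-- The class of a simplex in the normalized chains; it is zero for a degenerate simplex. -/
def cls (F : Type u) [Field F] {r n : ℕ} (x : Simplex r n) : E F r n :=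
  if h : x.Nondegenerate then Finsupp.single ⟨x, h⟩ 1 else 0

/-- The differential of `E(r)`, the alternating sum of the faces. -/
def bd {r n : ℕ} : E F r (n + 1) →ₗ[F] E F r n :=
  Finsupp.linearCombination F fun x =>
    ∑ i : Fin (n + 2), (-1 : F) ^ (i : ℕ) • cls F fun t => x.1 (i.succAbove t)

/-- The left action of the symmetric group, `w • (w_0, ..., w_n) = (w w_0, ..., w w_n)`. -/
def act {r n : ℕ} (w : Equiv.Perm (Fin r)) : E F r n →ₗ[F] E F r n :=
  Finsupp.linearCombination F fun x => cls F fun t => w * x.1 t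

/-- The operad unit, the vertex of `W(1)`. -/
def one (F : Type u) [Field F] : E F 1 0 := cls F fun _ => 1

/-- Substitution of permutations: in the word of `u`, the letter `i` is replaced by the word of
`v i`, written in the letters of the `i`-th block. -/
def subst {r : ℕ} {s : Fin r → ℕ} (u : Equiv.Perm (Fin r)) (v : ∀ i, Equiv.Perm (Fin (s i))) :
    Equiv.Perm (Fin (∑ i, s i)) :=
  (finCongr (Equiv.sum_comp u s).symm).trans <|
    finSigmaFinEquiv.symm.trans <|
      (Equiv.sigmaCongrLeft (β := fun i => Fin (s i)) u).trans <|
        (Equiv.sigmaCongrRight v).trans finSigmaFinEquiv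

/-- The shuffles of type `(n, m_1, ..., m_r)`, as words with `n` letters `0` and `m_i`
letters `i`. Such a word is a maximal chain in the poset `[n] × [m_1] × ... × [m_r]`: the letter at
time `t` tells which coordinate moves in the `t`-th step. -/
abbrev Shuffle {r : ℕ} (n : ℕ) (m : Fin r → ℕ) : Type :=
  {c : Fin (n + ∑ i, m i) → Fin (r + 1) //
    (Finset.univ.filter fun a => c a = 0).card = n ∧
      ∀ i : Fin r, (Finset.univ.filter fun a => c a = i.succ).card = m i}

/-- The number of letters `j` which a word has before the time `t`. -/
def Shuffle.count {r N : ℕ} (c : Fin N → Fin (r + 1)) (j : Fin (r + 1)) (t : Fin (N + 1)) : ℕ :=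
  (Finset.univ.filter fun a : Fin N => a.castSucc < t ∧ c a = j).card

theorem Shuffle.count_le {r N : ℕ} (c : Fin N → Fin (r + 1)) (j : Fin (r + 1)) (t : Fin (N + 1)) :
    Shuffle.count c j t ≤ (Finset.univ.filter fun a => c a = j).card :=
  Finset.card_le_card fun a ha => by
    simp only [Finset.mem_filter] at ha ⊢
    exact ⟨ha.1, ha.2.2⟩

/-- The coordinate in `[n]` of the `t`-th vertex of the chain. -/
def Shuffle.pos₀ {r n : ℕ} {m : Fin r → ℕ} (c : Shuffle n m) (t : Fin (n + ∑ i, m i + 1)) :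
    Fin (n + 1) :=
  ⟨Shuffle.count c.1 0 t, Nat.lt_succ_of_le ((Shuffle.count_le c.1 0 t).trans c.2.1.le)⟩

/-- The coordinate in `[m_i]` of the `t`-th vertex of the chain. -/
def Shuffle.pos {r n : ℕ} {m : Fin r → ℕ} (c : Shuffle n m) (i : Fin r)
    (t : Fin (n + ∑ i, m i + 1)) : Fin (m i + 1) :=
  ⟨Shuffle.count c.1 i.succ t,
    Nat.lt_succ_of_le ((Shuffle.count_le c.1 i.succ t).trans (c.2.2 i).le)⟩

/-- The signature of a shuffle, `(-1)` to the number of inversions of the word. -/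
def Shuffle.sign (F : Type u) [Field F] {r n : ℕ} {m : Fin r → ℕ} (c : Shuffle n m) : F :=
  (-1) ^ (Finset.univ.filter fun p : Fin (n + ∑ i, m i) × Fin (n + ∑ i, m i) =>
    p.1 < p.2 ∧ c.1 p.2 < c.1 p.1).card

/-- The composite `x(y_1, ..., y_r)` of simplices: the Eilenberg-Zilber (shuffle) map followed by
the substitution of permutations, applied vertexwise. -/
def compSimplex (F : Type u) [Field F] {r n : ℕ} {s m : Fin r → ℕ} (x : Simplex r n)
    (y : ∀ i, Simplex (s i) (m i)) : E F (∑ i, s i) (n + ∑ i, m i) :=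
  ∑ c : Shuffle n m, c.sign F • cls F fun t => subst (x (c.pos₀ t)) fun i => y i (c.pos i t)

/-- The composition product `E(r) ⊗ E(s_1) ⊗ ... ⊗ E(s_r) → E(s_1 + ... + s_r)`, the multilinear
extension of the composite of simplices. -/
def comp {r n : ℕ} {s m : Fin r → ℕ} (ρ : E F r n) (σ : ∀ i, E F (s i) (m i)) :
    E F (∑ i, s i) (n + ∑ i, m i) :=
  ∑ x : NSimplex r n, ∑ y : (∀ i, NSimplex (s i) (m i)),
    (ρ x * ∏ i, σ i (y i)) • compSimplex F x.1 fun i => (y i).1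

/-- The front face `(w_0, ..., w_k)`. -/
def front {r n : ℕ} (x : Simplex r n) (k : Fin (n + 1)) : Simplex r k :=
  fun t => x ⟨t, by omega⟩

/-- The back face `(w_k, ..., w_n)`. -/
def back {r n : ℕ} (x : Simplex r n) (k : Fin (n + 1)) : Simplex r (n - k) :=
  fun t => x ⟨k + t, by omega⟩

/-- The diagonal `Δ(w_0, ..., w_n) = ∑ₖ (w_0, ..., w_k) ⊗ (w_k, ..., w_n)`. The target is the
degree `n` part of `E(r) ⊗ E(r)`. -/
def diagonal {r n : ℕ} : E F r n →ₗ[F] ∀ k : Fin (n + 1), E F r k ⊗[F] E F r (n - k) :=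
  Finsupp.linearCombination F fun x k => cls F (front x.1 k) ⊗ₜ[F] cls F (back x.1 k)

end Operad

/-! ### Signs, dg-modules and tensor powers -/

/-- The sign `(-1)^k`. -/
def sgn (F : Type u) [Field F] (k : ℤ) : F := ((k.negOnePow : ℤ) : F)

/-- The sign of `f_1 ⊗ ... ⊗ f_r ⊗ x_1 ⊗ ... ⊗ x_r ↦ f_1 ⊗ x_1 ⊗ ... ⊗ f_r ⊗ x_r`, for `f_i` of
degree `m i` and `x_i` of degree `d i`. -/
def koszul (F : Type u) [Field F] {r : ℕ} (m d : Fin r → ℤ) : F :=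
  sgn F (∑ i, ∑ j, if j < i then m i * d j else 0)

/-- The sign of the permutation of a tensor `x_1 ⊗ ... ⊗ x_r` which puts the factor `x_i`, of
degree `d i`, in position `w i`. -/
def permSign (F : Type u) [Field F] {r : ℕ} (w : Equiv.Perm (Fin r)) (d : Fin r → ℤ) : F :=
  sgn F (∑ i, ∑ j, if i < j ∧ w j < w i then d i * d j else 0)

/-- Upper graded dg-modules over `F`. -/
abbrev DG (F : Type u) [Field F] := CochainComplex (ModuleCat.{u} F) ℤ

/-- The multidegree `d` with `1` added to the `i`-th entry. -/
abbrev bump {r : ℕ} (d : Fin r → ℤ) (i : Fin r) : Fin r → ℤ := Function.update d i (d i + 1)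

theorem sum_bump {r : ℕ} (d : Fin r → ℤ) (i : Fin r) : ∑ j, bump d i j = ∑ j, d j + 1 := by
  rw [Finset.sum_update_of_mem (Finset.mem_univ i), ← Finset.add_sum_erase _ d (Finset.mem_univ i),
    Finset.sdiff_singleton_eq_erase]
  ring

section DG

variable {F : Type u} [Field F]

/-- The `j`-th factor of `id ⊗ ... ⊗ δ ⊗ ... ⊗ id`, with `δ` in the `i`-th place. -/
def slot (V : DG F) {r : ℕ} (d : Fin r → ℤ) (i j : Fin r) :
    V.X (d j) →ₗ[F] V.X (bump d i j) :=
  if h : j = i then (V.d (d j) (bump d i j)).hom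
  else (V.XIsoOfEq (Function.update_of_ne h _ _).symm).hom.hom

/-- The tensor power `V^{⊗ r}` of a dg-module: the sum over the multidegrees `d` of the tensor
products `V^{d_1} ⊗ ... ⊗ V^{d_r}`. The summand of `d` has the degree `d_1 + ... + d_r`. -/
abbrev TPow (V : DG F) (r : ℕ) : Type u := ⨁ d : Fin r → ℤ, ⨂[F] i, V.X (d i)

/-- The differential of `V^{⊗ r}`. -/
def TPow.diff (V : DG F) (r : ℕ) : TPow V r →ₗ[F] TPow V r :=
  DirectSum.toModule F _ _ fun d => ∑ i : Fin r,
    sgn F (∑ j, if j < i then d j else 0) •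
      (DirectSum.lof F (Fin r → ℤ) (fun d => ⨂[F] i, V.X (d i)) (bump d i) ∘ₗ
        PiTensorProduct.map (slot V d i))

/-- The action of a permutation on `V^{⊗ r}`: the `i`-th factor moves to the place `w i`. -/
def TPow.perm (V : DG F) {r : ℕ} (w : Equiv.Perm (Fin r)) : TPow V r →ₗ[F] TPow V r :=
  DirectSum.toModule F _ _ fun d => permSign F w d •
    (DirectSum.lof F (Fin r → ℤ) (fun d => ⨂[F] i, V.X (d i)) (fun i => d (w.symm i)) ∘ₗ
      (PiTensorProduct.reindex F (fun i => V.X (d i)) w).toLinearMap)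

theorem update_block {r : ℕ} {s : Fin r → ℕ} {M : Fin (∑ i, s i) → Type*} {N : Fin r → Type*}
    (g : ∀ i, (∀ j, M (finSigmaFinEquiv ⟨i, j⟩)) → N i) (x : ∀ k, M k) (i : Fin r) (j : Fin (s i))
    (y : M (finSigmaFinEquiv ⟨i, j⟩)) :
    (fun i' => g i' fun j' => Function.update x (finSigmaFinEquiv ⟨i, j⟩) y
      (finSigmaFinEquiv ⟨i', j'⟩)) =
      Function.update (fun i' => g i' fun j' => x (finSigmaFinEquiv ⟨i', j'⟩)) i
        (g i (Function.update (fun j' => x (finSigmaFinEquiv ⟨i, j'⟩)) j y)) := by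
  funext i'
  by_cases h : i' = i
  · subst h
    rw [Function.update_self]
    congr 1
    funext j'
    by_cases h' : j' = j
    · subst h'
      simp
    · rw [Function.update_of_ne h', Function.update_of_ne]
      simpa using h'
  · rw [Function.update_of_ne h]
    congr 1
    funext j'
    rw [Function.update_of_ne]
    intro e
    exact h (congrArg Sigma.fst (finSigmaFinEquiv.injective e))

/-- The canonical map `V^{⊗ (s_1 + ... + s_r)} → V^{⊗ s_1} ⊗ ... ⊗ V^{⊗ s_r}`, which puts brackets
in a tensor. -/
def TPow.nest (V : DG F) {r : ℕ} (s : Fin r → ℕ) :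
    TPow V (∑ i, s i) →ₗ[F] ⨂[F] i, TPow V (s i) :=
  DirectSum.toModule F _ _ fun d => PiTensorProduct.lift
    { toFun := fun x => PiTensorProduct.tprod F fun i =>
        DirectSum.lof F (Fin (s i) → ℤ) (fun d => ⨂[F] j, V.X (d j))
          (fun j => d (finSigmaFinEquiv ⟨i, j⟩))
          (PiTensorProduct.tprod F fun j => x (finSigmaFinEquiv ⟨i, j⟩))
      map_update_add' := by
        intro inst x k y z
        obtain rfl : inst = instDecidableEqFin _ := Subsingleton.elim _ _
        obtain ⟨⟨i, j⟩, rfl⟩ := finSigmaFinEquiv.surjective k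
        have key := fun y => update_block (M := fun k => V.X (d k)) (fun i x =>
          DirectSum.lof F (Fin (s i) → ℤ) (fun d => ⨂[F] j, V.X (d j))
            (fun j => d (finSigmaFinEquiv ⟨i, j⟩)) (PiTensorProduct.tprod F x)) x i j y
        simp only [key, MultilinearMap.map_update_add, map_add]
      map_update_smul' := by
        intro inst x k a y
        obtain rfl : inst = instDecidableEqFin _ := Subsingleton.elim _ _
        obtain ⟨⟨i, j⟩, rfl⟩ := finSigmaFinEquiv.surjective k
        have key := fun y => update_block (M := fun k => V.X (d k)) (fun i x =>
          DirectSum.lof F (Fin (s i) → ℤ) (fun d => ⨂[F] j, V.X (d j))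
            (fun j => d (finSigmaFinEquiv ⟨i, j⟩)) (PiTensorProduct.tprod F x)) x i j y
        simp only [key, MultilinearMap.map_update_smul, map_smul] }

end DG

/-! ### Algebras and coalgebras -/

/-- A dg-module `A` with maps `E(r) ⊗ A^{⊗ r} → A` of graded modules: an element `ρ` of lower
degree `n` sends elements of degrees `d_1, ..., d_r` to an element of degree
`e = d_1 + ... + d_r - n`. No relation is imposed yet. -/
structure EAlgebraData (F : Type u) [Field F] where
  cx : DG F
  op : ∀ {r n : ℕ} (d : Fin r → ℤ) (e : ℤ), e + n = ∑ i, d i →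
    (E F r n →ₗ[F] MultilinearMap F (fun i => cx.X (d i)) (cx.X e))

/-- The axioms of an algebra over the operad `E`. -/
structure EAlgebraData.IsEAlgebra {F : Type u} [Field F] (A : EAlgebraData F) : Prop where
  /-- `1(a) = a` -/
  op_one : ∀ (e : ℤ) (h : e + (0 : ℕ) = ∑ _i : Fin 1, e) (a : Fin 1 → A.cx.X e),
    A.op (fun _ => e) e h (one F) a = a 0
  /-- `ρ(σ_1, ..., σ_r)(a_{11}, ..., a_{r s_r}) = ± ρ(σ_1(a_{11}, ...), ..., σ_r(a_{r1}, ...))` -/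
  op_comp : ∀ {r n : ℕ} {s m : Fin r → ℕ} (ρ : E F r n) (σ : ∀ i, E F (s i) (m i))
    (d : Fin (∑ i, s i) → ℤ) (d' : Fin r → ℤ) (e : ℤ)
    (h : e + ((n + ∑ i, m i : ℕ) : ℤ) = ∑ k, d k)
    (h' : ∀ i, d' i + m i = ∑ j, d (finSigmaFinEquiv ⟨i, j⟩)) (h'' : e + n = ∑ i, d' i)
    (a : ∀ k, A.cx.X (d k)),
    A.op d e h (comp ρ σ) a =
      koszul F (fun i => m i) (fun i => ∑ j, d (finSigmaFinEquiv ⟨i, j⟩)) •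
        A.op d' e h'' ρ fun i =>
          A.op (fun j => d (finSigmaFinEquiv ⟨i, j⟩)) (d' i) (h' i) (σ i)
            fun j => a (finSigmaFinEquiv ⟨i, j⟩)
  /-- `(wρ)(a_1, ..., a_r) = ± ρ(a_{w(1)}, ..., a_{w(r)})` -/
  op_act : ∀ {r n : ℕ} (w : Equiv.Perm (Fin r)) (ρ : E F r n) (d : Fin r → ℤ) (e : ℤ)
    (h : e + n = ∑ i, d i) (a : ∀ i, A.cx.X (d i)),
    A.op d e h (act w ρ) a =
      permSign F w (fun i => d (w i)) •
        A.op (fun i => d (w i)) e (h.trans (Equiv.sum_comp w d).symm) ρ fun i => a (w i)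
  /-- `δ(ρ(a_1, ..., a_r)) = ∑ ± ρ(a_1, ..., δ a_i, ..., a_r)` for `ρ` of degree zero -/
  op_diff_zero : ∀ {r : ℕ} (ρ : E F r 0) (d : Fin r → ℤ) (e : ℤ)
    (h : e + (0 : ℕ) = ∑ i, d i) (a : ∀ i, A.cx.X (d i)),
    A.cx.d e (e + 1) (A.op d e h ρ a) =
      ∑ i, sgn F (∑ j, if j < i then d j else 0) •
        A.op (bump d i) (e + 1) (by rw [sum_bump, ← h]; ring) ρ fun j => slot A.cx d i j (a j)
  /-- `δ(ρ(a_1, ..., a_r)) = (δρ)(a_1, ..., a_r) + ∑ ± ρ(a_1, ..., δ a_i, ..., a_r)` for `ρ` of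
  positive degree -/
  op_diff_succ : ∀ {r n : ℕ} (ρ : E F r (n + 1)) (d : Fin r → ℤ) (e : ℤ)
    (h : e + (n + 1 : ℕ) = ∑ i, d i) (a : ∀ i, A.cx.X (d i)),
    A.cx.d e (e + 1) (A.op d e h ρ a) =
      A.op d (e + 1) (by rw [← h]; push_cast; ring) (bd ρ) a +
      ∑ i, sgn F ((n + 1 : ℕ) + ∑ j, if j < i then d j else 0) •
        A.op (bump d i) (e + 1) (by rw [sum_bump, ← h]; ring) ρ fun j => slot A.cx d i j (a j)

/-- Algebras over the operad `E`. -/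
structure EAlgebra (F : Type u) [Field F] extends EAlgebraData F where
  isEAlgebra : toEAlgebraData.IsEAlgebra

/-- Morphisms of `E`-algebras: morphisms of dg-modules which commute with the operations. -/
@[ext]
structure EAlgebra.Hom {F : Type u} [Field F] (A B : EAlgebra F) where
  hom : A.cx ⟶ B.cx
  map_op : ∀ {r n : ℕ} (d : Fin r → ℤ) (e : ℤ) (h : e + n = ∑ i, d i) (ρ : E F r n)
    (a : ∀ i, A.cx.X (d i)),
    hom.f e (A.op d e h ρ a) = B.op d e h ρ fun i => hom.f (d i) (a i)

instance (F : Type u) [Field F] : Category (EAlgebra F) where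
  Hom := EAlgebra.Hom
  id A := { hom := 𝟙 _, map_op := by intros; simp }
  comp f g := { hom := f.hom ≫ g.hom, map_op := by intros; simp [f.map_op, g.map_op] }

/-- Coalgebras over the operad `E`: dg-modules `K` with a coproduct `E(r) ⊗ K → K^{⊗ r}`. The
element `ρ` gives the co-operation `co ρ`, which is denoted by `ρ^*` below. -/
structure ECoalgebra (F : Type u) [Field F] where
  cx : DG F
  co : ∀ {r n : ℕ} (p : ℤ), E F r n →ₗ[F] cx.X p →ₗ[F] TPow cx r
  /-- `ρ^*` lowers the upper degree by the lower degree of `ρ` -/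
  co_degree : ∀ {r n : ℕ} (p : ℤ) (ρ : E F r n) (c : cx.X p) (d : Fin r → ℤ),
    ∑ i, d i + n ≠ p → co p ρ c d = 0
  /-- `1^* = id` -/
  co_one : ∀ (p : ℤ) (c : cx.X p),
    co p (one F) c = DirectSum.lof F (Fin 1 → ℤ) (fun d => ⨂[F] i, cx.X (d i)) (fun _ => p)
      (PiTensorProduct.tprod F fun _ => c)
  /-- `ρ(σ_1, ..., σ_r)^* = ± (σ_1^* ⊗ ... ⊗ σ_r^*) ρ^*` -/
  co_comp : ∀ {r n : ℕ} {s m : Fin r → ℕ} (ρ : E F r n) (σ : ∀ i, E F (s i) (m i)) (p : ℤ)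
    (c : cx.X p),
    TPow.nest cx s (co p (comp ρ σ) c) =
      sgn F (n * ∑ i, m i) •
        DirectSum.toModule F (Fin r → ℤ) (⨂[F] i, TPow cx (s i))
          (fun d => koszul F (fun i => m i) d •
            PiTensorProduct.map fun i => co (d i) (σ i)) (co p ρ c)
  /-- `(wρ)^* = w ρ^*` -/
  co_act : ∀ {r n : ℕ} (w : Equiv.Perm (Fin r)) (ρ : E F r n) (p : ℤ) (c : cx.X p),
    co p (act w ρ) c = TPow.perm cx w (co p ρ c)
  /-- `δ(ρ^*(c)) = ρ^*(δ c)` for `ρ` of degree zero -/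
  co_diff_zero : ∀ {r : ℕ} (ρ : E F r 0) (p : ℤ) (c : cx.X p),
    TPow.diff cx r (co p ρ c) = co (p + 1) ρ (cx.d p (p + 1) c)
  /-- `δ(ρ^*(c)) = (δρ)^*(c) ± ρ^*(δ c)` for `ρ` of positive degree -/
  co_diff_succ : ∀ {r n : ℕ} (ρ : E F r (n + 1)) (p : ℤ) (c : cx.X p),
    TPow.diff cx r (co p ρ c) =
      co p (bd ρ) c + sgn F (n + 1 : ℕ) • co (p + 1) ρ (cx.d p (p + 1) c)

/-! ### The functor `Hom_F(K, -)` -/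

section HomAlgebra

open CochainComplex.HomComplex

variable {F : Type u} [Field F]

/-- The dg-module `Hom_F(K, A)` of homogeneous morphisms, with the differential
`δ(f) = δ f - (-1)^{deg f} f δ`. -/
def homComplex (K A : DG F) : DG F where
  X n := ModuleCat.of F (Cochain K A n)
  d n m := ModuleCat.ofHom (δ_hom F K A n m)
  shape n m h := by
    apply ModuleCat.hom_ext
    apply LinearMap.ext
    intro z
    exact δ_shape n m h z
  d_comp_d' i j k _ _ := by
    apply ModuleCat.hom_ext
    apply LinearMap.ext
    intro z
    exact δ_δ i j k z

/-- The component `K^p → A^q` of a homogeneous morphism. -/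
def component (K A : DG F) (n p q : ℤ) (h : p + n = q) :
    Cochain K A n →ₗ[F] K.X p →ₗ[F] A.X q where
  toFun z := (z.v p q h).hom
  map_add' _ _ := rfl
  map_smul' _ _ := rfl

/-- For a multilinear map `g` on `A`, the map which sends homogeneous morphisms `u_1, ..., u_r` of
degrees `d_1, ..., d_r` to `x_1 ⊗ ... ⊗ x_r ↦ g(u_1(x_1), ..., u_r(x_r))` for `x_i` of
degree `d'_i`. -/
def applyTensor (K A : DG F) {r : ℕ} (d d' : Fin r → ℤ) {N : Type u} [AddCommGroup N] [Module F N]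
    (g : MultilinearMap F (fun i => A.X (d' i + d i)) N) :
    MultilinearMap F (fun i => Cochain K A (d i)) ((⨂[F] i, K.X (d' i)) →ₗ[F] N) :=
  (PiTensorProduct.lift.toLinearMap.compMultilinearMap (MultilinearMap.piLinearMap g)).compLinearMap
    fun i => component K A (d i) (d' i) (d' i + d i) rfl

theorem applyTensor_tprod (K A : DG F) {r : ℕ} (d d' : Fin r → ℤ) {N : Type u} [AddCommGroup N]
    [Module F N] (g : MultilinearMap F (fun i => A.X (d' i + d i)) N)
    (z : ∀ i, Cochain K A (d i)) (x : ∀ i, K.X (d' i)) :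
    applyTensor K A d d' g z (PiTensorProduct.tprod F x) =
      g fun i => ((z i).v (d' i) (d' i + d i) rfl).hom (x i) := by
  simp only [applyTensor, MultilinearMap.compLinearMap_apply,
    LinearMap.compMultilinearMap_apply, LinearEquiv.coe_coe, PiTensorProduct.lift.tprod]
  rfl

theorem hom_degree {r p q : ℕ} {d d' : Fin r → ℤ} {e a b : ℤ} (h : e + (p + q : ℕ) = ∑ i, d i)
    (hab : a + e = b) (h' : ∑ i, d' i + q = a) : b + p = ∑ i, (d' i + d i) := by
  rw [Finset.sum_add_distrib, ← h, ← hab, ← h']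
  push_cast
  ring

/-- The component `K^a → A^b` of `± ρ₁ · (u_1 ⊗ ... ⊗ u_r) · ρ₂^*`, as a function of the
homogeneous morphisms `u_1, ..., u_r`. The first sign comes from the permutation of `ρ₂` with
`u_1 ⊗ ... ⊗ u_r`, the second one from the evaluation of `u_1 ⊗ ... ⊗ u_r` on a tensor. -/
def pairOpComponent (K : ECoalgebra F) (A : EAlgebra F) {r p q : ℕ} (d : Fin r → ℤ) (e : ℤ)
    (h : e + (p + q : ℕ) = ∑ i, d i) (ρ₁ : E F r p) (ρ₂ : E F r q) (a b : ℤ) (hab : a + e = b) :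
    MultilinearMap F (fun i => Cochain K.cx A.cx (d i)) (K.cx.X a →ₗ[F] A.cx.X b) :=
  ((K.co a ρ₂).lcomp F (A.cx.X b) ∘ₗ (DFinsupp.lsum F).toLinearMap).compMultilinearMap <|
    MultilinearMap.pi fun d' : Fin r → ℤ =>
      if h' : ∑ i, d' i + q = a then
        (sgn F (q * ∑ i, d i) * koszul F d d') •
          applyTensor K.cx A.cx d d'
            (A.op (fun i => d' i + d i) b (hom_degree h hab h') ρ₁)
      else 0

theorem pairOpComponent_apply (K : ECoalgebra F) (A : EAlgebra F) {r p q : ℕ} (d : Fin r → ℤ)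
    (e : ℤ) (h : e + (p + q : ℕ) = ∑ i, d i) (ρ₁ : E F r p) (ρ₂ : E F r q) (a b : ℤ)
    (hab : a + e = b) (z : ∀ i, Cochain K.cx A.cx (d i)) (c : K.cx.X a) :
    pairOpComponent K A d e h ρ₁ ρ₂ a b hab z c =
      DirectSum.toModule F (Fin r → ℤ) (A.cx.X b) (fun d' =>
        if h' : ∑ i, d' i + q = a then
          (sgn F (q * ∑ i, d i) * koszul F d d') •
            applyTensor K.cx A.cx d d'
              (A.op (fun i => d' i + d i) b (hom_degree h hab h') ρ₁) z
        else 0) (K.co a ρ₂ c) := by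
  have : ∀ (f g : ∀ d' : Fin r → ℤ, (⨂[F] i, K.cx.X (d' i)) →ₗ[F] A.cx.X b) (t : TPow K.cx r),
      f = g → DFinsupp.lsum F f t = DirectSum.toModule F (Fin r → ℤ) (A.cx.X b) g t := by
    rintro f _ t rfl
    rfl
  refine this _ _ _ ?_
  funext d'
  change (dite _ _ _ : MultilinearMap F _ _) z = _
  split_ifs <;> rfl

theorem toModule_add {V : DG F} {r : ℕ} {N : Type u} [AddCommGroup N] [Module F N]
    (f g : ∀ d : Fin r → ℤ, (⨂[F] i, V.X (d i)) →ₗ[F] N) (t : TPow V r) :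
    DirectSum.toModule F (Fin r → ℤ) N (fun d => f d + g d) t =
      DirectSum.toModule F (Fin r → ℤ) N f t + DirectSum.toModule F (Fin r → ℤ) N g t := by
  rw [← LinearMap.add_apply]
  congr 1
  apply DirectSum.linearMap_ext
  intro d
  ext x
  simp [DirectSum.toModule_lof]

theorem toModule_smul {V : DG F} {r : ℕ} {N : Type u} [AddCommGroup N] [Module F N] (k : F)
    (f : ∀ d : Fin r → ℤ, (⨂[F] i, V.X (d i)) →ₗ[F] N) (t : TPow V r) :
    DirectSum.toModule F (Fin r → ℤ) N (fun d => k • f d) t =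
      k • DirectSum.toModule F (Fin r → ℤ) N f t := by
  rw [← LinearMap.smul_apply]
  congr 1
  apply DirectSum.linearMap_ext
  intro d
  ext x
  simp [DirectSum.toModule_lof]

theorem applyTensor_add (K A : DG F) {r : ℕ} (d d' : Fin r → ℤ) {N : Type u} [AddCommGroup N]
    [Module F N] (g g' : MultilinearMap F (fun i => A.X (d' i + d i)) N) :
    applyTensor K A d d' (g + g') = applyTensor K A d d' g + applyTensor K A d d' g' := by
  apply MultilinearMap.ext
  intro z
  apply PiTensorProduct.ext
  ext x
  simp [applyTensor_tprod]

theorem applyTensor_smul (K A : DG F) {r : ℕ} (d d' : Fin r → ℤ) {N : Type u} [AddCommGroup N]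
    [Module F N] (k : F) (g : MultilinearMap F (fun i => A.X (d' i + d i)) N) :
    applyTensor K A d d' (k • g) = k • applyTensor K A d d' g := by
  apply MultilinearMap.ext
  intro z
  apply PiTensorProduct.ext
  ext x
  simp [applyTensor_tprod]

/-- The homogeneous morphism `± ρ₁ · (u_1 ⊗ ... ⊗ u_r) · ρ₂^*`. -/
def pairOp (K : ECoalgebra F) (A : EAlgebra F) {r p q : ℕ} (d : Fin r → ℤ) (e : ℤ)
    (h : e + (p + q : ℕ) = ∑ i, d i) :
    E F r p →ₗ[F] E F r q →ₗ[F]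
      MultilinearMap F (fun i => Cochain K.cx A.cx (d i)) (Cochain K.cx A.cx e) :=
  LinearMap.mk₂ F
    (fun ρ₁ ρ₂ =>
      { toFun := fun z => Cochain.mk fun a b hab =>
          ModuleCat.ofHom (pairOpComponent K A d e h ρ₁ ρ₂ a b hab z)
        map_update_add' := by
          intro _ z i x y
          ext a b hab c
          simp
        map_update_smul' := by
          intro _ z i x y
          ext a b hab c
          simp })
    (by
      intro ρ₁ ρ₁' ρ₂
      ext z a b hab c
      change pairOpComponent K A d e h _ ρ₂ a b hab z c =
        pairOpComponent K A d e h _ ρ₂ a b hab z c + pairOpComponent K A d e h _ ρ₂ a b hab z c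
      rw [pairOpComponent_apply, pairOpComponent_apply, pairOpComponent_apply, ← toModule_add]
      congr 2
      funext d'
      split_ifs
      · rw [map_add, applyTensor_add, _root_.add_apply, smul_add]
      · rw [add_zero])
    (by
      intro k ρ₁ ρ₂
      ext z a b hab c
      change pairOpComponent K A d e h _ ρ₂ a b hab z c =
        k • pairOpComponent K A d e h _ ρ₂ a b hab z c
      rw [pairOpComponent_apply, pairOpComponent_apply, ← toModule_smul]
      congr 2
      funext d'
      split_ifs
      · rw [map_smul, applyTensor_smul, _root_.smul_apply, smul_comm]
      · rw [smul_zero])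
    (by
      intro ρ₁ ρ₂ ρ₂'
      ext z a b hab c
      simp [pairOpComponent_apply])
    (by
      intro k ρ₁ ρ₂
      ext z a b hab c
      simp [pairOpComponent_apply])

/-- The operation of `ρ` on `Hom_F(K, A)`: with `Δ(ρ) = ∑ ρ₁ ⊗ ρ₂`, the homogeneous morphism
`ρ(u_1, ..., u_r)` is the sum of the composites `± ρ₁ · (u_1 ⊗ ... ⊗ u_r) · ρ₂^*`. -/
def homOp (K : ECoalgebra F) (A : EAlgebra F) {r n : ℕ} (d : Fin r → ℤ) (e : ℤ)
    (h : e + n = ∑ i, d i) :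
    E F r n →ₗ[F]
      MultilinearMap F (fun i => Cochain K.cx A.cx (d i)) (Cochain K.cx A.cx e) :=
  ∑ k : Fin (n + 1),
    TensorProduct.lift (pairOp K A (p := k) (q := n - k) d e
      (by rw [Nat.add_sub_of_le (Nat.le_of_lt_succ k.2), h])) ∘ₗ LinearMap.proj k ∘ₗ diagonal

/-- The dg-module `Hom_F(K, A)` with the operations of the elements of `E`. -/
def homData (K : ECoalgebra F) (A : EAlgebra F) : EAlgebraData F where
  cx := homComplex K.cx A.cx
  op d e h := homOp K A d e h

/-- The morphism of dg-modules `Hom_F(K, f) : u ↦ f u`. -/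
def homMap (K : DG F) {A B : DG F} (f : A ⟶ B) : homComplex K A ⟶ homComplex K B where
  f n := ModuleCat.ofHom
    { toFun := fun z : Cochain K A n => z.comp (Cochain.ofHom f) (add_zero n)
      map_add' := fun z z' => Cochain.add_comp z z' _ _
      map_smul' := fun a z => Cochain.smul_comp a z _ _ }
  comm' n m _ := by
    apply ModuleCat.hom_ext
    apply LinearMap.ext
    intro z
    exact δ_comp_ofHom z f m

theorem pairOpComponent_map (K : ECoalgebra F) {A B : EAlgebra F} (f : A ⟶ B) {r p q : ℕ}
    (d : Fin r → ℤ) (e : ℤ) (h : e + (p + q : ℕ) = ∑ i, d i) (ρ₁ : E F r p) (ρ₂ : E F r q)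
    (a b : ℤ) (hab : a + e = b) (z : ∀ i, Cochain K.cx A.cx (d i)) (c : K.cx.X a) :
    (f.hom.f b).hom (pairOpComponent K A d e h ρ₁ ρ₂ a b hab z c) =
      pairOpComponent K B d e h ρ₁ ρ₂ a b hab
        (fun i => (z i).comp (Cochain.ofHom f.hom) (add_zero (d i))) c := by
  rw [pairOpComponent_apply, pairOpComponent_apply, ← LinearMap.comp_apply]
  congr 1
  apply DirectSum.linearMap_ext
  intro d'
  apply PiTensorProduct.ext
  apply MultilinearMap.ext
  intro x
  simp only [LinearMap.compMultilinearMap_apply, LinearMap.comp_apply, DirectSum.toModule_lof]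
  split_ifs
  · rw [LinearMap.smul_apply, LinearMap.smul_apply, map_smul, applyTensor_tprod, applyTensor_tprod]
    congr 1
    refine (f.map_op _ _ _ _ _).trans ?_
    simp only [Cochain.comp_zero_cochain_v, Cochain.ofHom_v]
    rfl
  · simp

theorem homMap_op (K : ECoalgebra F) {A B : EAlgebra F} (f : A ⟶ B) {r n : ℕ} (d : Fin r → ℤ)
    (e : ℤ) (h : e + n = ∑ i, d i) (ρ : E F r n) (z : ∀ i, Cochain K.cx A.cx (d i)) :
    (homOp K A d e h ρ z).comp (Cochain.ofHom f.hom) (add_zero e) =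
      homOp K B d e h ρ fun i => (z i).comp (Cochain.ofHom f.hom) (add_zero (d i)) := by
  simp only [homOp, LinearMap.sum_apply, _root_.sum_apply, LinearMap.comp_apply,
    LinearMap.proj_apply]
  have hsum : ∀ (S : Finset (Fin (n + 1))) (y : Fin (n + 1) → Cochain K.cx A.cx e),
      (∑ k ∈ S, y k).comp (Cochain.ofHom f.hom) (add_zero e) =
        ∑ k ∈ S, (y k).comp (Cochain.ofHom f.hom) (add_zero e) := by
    intro S y
    induction S using Finset.induction_on with
    | empty => simp
    | insert k S hk ih => rw [Finset.sum_insert hk, Finset.sum_insert hk, Cochain.add_comp, ih]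
  rw [hsum]
  refine Finset.sum_congr rfl fun k _ => ?_
  generalize (diagonal ρ : ∀ k : Fin (n + 1), E F r k ⊗[F] E F r (n - k)) k = t
  induction t using TensorProduct.induction_on with
  | zero => simp
  | tmul x y =>
    rw [TensorProduct.lift.tmul, TensorProduct.lift.tmul]
    ext a b hab c
    rw [Cochain.comp_zero_cochain_v, Cochain.ofHom_v]
    exact pairOpComponent_map K f d e _ x y a b hab z c
  | add x y hx hy =>
    simp only [map_add, _root_.add_apply, Cochain.add_comp, hx, hy]

/-- The functor `Hom_F(K, -)` on the category of `E`-algebras. The relations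
of an `E`-algebra in `Hom_F(K, A)` enter as the proof `hK`; the functor does not depend on it
otherwise. -/
def homFunctor (K : ECoalgebra F) (hK : ∀ A : EAlgebra F, (homData K A).IsEAlgebra) :
    EAlgebra F ⥤ EAlgebra F where
  obj A := { homData K A with isEAlgebra := hK A }
  map f :=
    { hom := homMap K.cx f.hom
      map_op := fun d e h ρ z => homMap_op K f d e h ρ z }
  map_id A := by
    apply EAlgebra.Hom.ext
    ext n : 1
    apply ModuleCat.hom_ext
    apply LinearMap.ext
    intro z
    exact Cochain.comp_id (n := n) z
  map_comp f g := by
    apply EAlgebra.Hom.ext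
    ext n : 1
    apply ModuleCat.hom_ext
    apply LinearMap.ext
    intro z
    have key : ∀ {A B C : DG F} (f : A ⟶ B) (g : B ⟶ C) (z : Cochain K.cx A n),
        z.comp (Cochain.ofHom (f ≫ g)) (add_zero n) =
          (z.comp (Cochain.ofHom f) (add_zero n)).comp (Cochain.ofHom g) (add_zero n) := by
      intro A B C f g z
      rw [Cochain.ofHom_comp, Cochain.comp_assoc_of_third_is_zero_cochain]
    exact key f.hom g.hom z

end HomAlgebra

end BarrattEccles

end

/-!
Two facts have to be proved: the operations on `Hom_F(K, A)` satisfy the axioms of an `E`-algebra,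
and the functor `Hom_F(K, -)` which they define has a left adjoint.

*The axioms.* The operation of `ρ` on `Hom_F(K, A)` is the image of `Δ(ρ)` under the pairing
`ρ₁ ⊗ ρ₂ ↦ ± ρ₁ · (u_1 ⊗ ... ⊗ u_r) · ρ₂^*`, so that each axiom follows from a property of the
pairing, which rests on the axioms of `A` and `K`, and a property of the diagonal. For the
composition product, the property of the pairing is `pairing_comp`. The property of the diagonal
(the shuffle map commutes with the front and back faces) is `homOp_comp_chain`: a shuffle is
a lattice path, hence a word, and a path with a marked vertex is a pair of words
(`sum_shuffles_cut`). The inversions between the two parts of the word (`wordSign_append`) give the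
Koszul sign for the permutation of the factors of `Δ(ρ) ⊗ Δ(σ_1) ⊗ ... ⊗ Δ(σ_r)`. For the
differential, the two properties are `pairing_diff` and `homOp_bd_chain`. Degenerate simplices cause
no problem because the front or the back face of a cut of a degenerate simplex is degenerate
(`diagonal_chain`).

*The adjoint.* The elements of `A ⊘ K` are formal expressions in generators `a ⊗ c`, with `a` in `A`
and `c` in `K`, and in the operations of a dg-module over `E`. Two expressions are identified when
they take the same value in every `E`-algebra `B` under every morphism `A ⟶ Hom_F(K, B)`. This
condition quantifies over all `E`-algebras, but the expressions form a type in the universe of `F`,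
and so does their quotient. As values detect elements (`DivElem.ext_ev`), every equation which holds
in all the algebras `B` holds in `A ⊘ K`: this gives the axioms of an `E`-algebra, and shows that
`a ↦ (c ↦ a ⊗ c)` is a morphism `A ⟶ Hom_F(K, A ⊘ K)`, which is universal since the generators
generate.
-/

noncomputable section

namespace BarrattEccles

/-! ### Signs -/

section Signs

variable (F : Type u) [Field F]

theorem sgn_add (a b : ℤ) : sgn F (a + b) = sgn F a * sgn F b := by
  simp [sgn, Int.negOnePow_add]

theorem sgn_zero : sgn F 0 = 1 := by simp [sgn]

theorem sgn_natCast (n : ℕ) : sgn F n = (-1) ^ n := by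
  simp [sgn, Int.negOnePow]

theorem sgn_eq_of_eq_add_two_mul {a b : ℤ} (k : ℤ) (h : a = b + 2 * k) : sgn F a = sgn F b := by
  have h2 : Int.negOnePow (2 * k) = 1 := Int.negOnePow_even _ ⟨k, two_mul k⟩
  rw [h, sgn_add]
  simp [sgn, h2]

theorem sgn_congr {a b : ℤ} (h : (a : ZMod 2) = b) : sgn F a = sgn F b := by
  have : ((a - b : ℤ) : ZMod 2) = 0 := by push_cast; rw [h, sub_self]
  rw [ZMod.intCast_zmod_eq_zero_iff_dvd] at this
  obtain ⟨k, hk⟩ := this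
  exact sgn_eq_of_eq_add_two_mul F k (by push_cast at hk; linarith)

theorem sgn_mul_self (a : ℤ) : sgn F a * sgn F a = 1 := by
  rw [← sgn_add, ← sgn_zero F]
  exact sgn_congr F (by push_cast; exact CharTwo.add_self_eq_zero _)

end Signs

theorem prod_sgn (F : Type u) [Field F] {r : ℕ} (f : Fin r → ℤ) :
    ∏ i, sgn F (f i) = sgn F (∑ i, f i) := by
  induction (Finset.univ : Finset (Fin r)) using Finset.induction_on with
  | empty => simp [sgn_zero]
  | insert i S hi ih => rw [Finset.prod_insert hi, Finset.sum_insert hi, sgn_add, ih]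

/-- The sum of the products `f i * g j` over the pairs `j < i`. Modulo `2`, it is the exponent of
the sign which arises when each `f i` is moved across the `g j` with `j < i`. -/
def cross {R : Type*} [CommRing R] {r : ℕ} (f g : Fin r → R) : R :=
  ∑ i, ∑ j, if j < i then f i * g j else 0

section Cross

variable {R : Type*} [CommRing R] {r : ℕ}

theorem cross_add_left (f f' g : Fin r → R) :
    cross (fun i => f i + f' i) g = cross f g + cross f' g := by
  simp only [cross, ← Finset.sum_add_distrib]
  refine Finset.sum_congr rfl fun i _ => Finset.sum_congr rfl fun j _ => ?_
  split_ifs <;> ring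

theorem cross_add_right (f g g' : Fin r → R) :
    cross f (fun i => g i + g' i) = cross f g + cross f g' := by
  simp only [cross, ← Finset.sum_add_distrib]
  refine Finset.sum_congr rfl fun i _ => Finset.sum_congr rfl fun j _ => ?_
  split_ifs <;> ring

theorem cross_neg_left (f g : Fin r → R) : cross (fun i => -f i) g = -cross f g := by
  simp only [cross, ← Finset.sum_neg_distrib]
  refine Finset.sum_congr rfl fun i _ => Finset.sum_congr rfl fun j _ => ?_
  split_ifs <;> ring

theorem cross_sub_left (f f' g : Fin r → R) :
    cross (fun i => f i - f' i) g = cross f g - cross f' g := by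
  simp only [sub_eq_add_neg, cross_add_left, cross_neg_left]

theorem cross_neg_right (f g : Fin r → R) : cross f (fun i => -g i) = -cross f g := by
  simp only [cross, ← Finset.sum_neg_distrib]
  refine Finset.sum_congr rfl fun i _ => Finset.sum_congr rfl fun j _ => ?_
  split_ifs <;> ring

theorem cross_sub_right (f g g' : Fin r → R) :
    cross f (fun i => g i - g' i) = cross f g - cross f g' := by
  simp only [sub_eq_add_neg, cross_add_right, cross_neg_right]

/-- The pairs `(i, j)` are split into those with `j < i`, those with `i < j` and those with
`i = j`. -/
theorem sum_mul_sum_eq_cross (f g : Fin r → R) :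
    (∑ i, f i) * ∑ i, g i = cross f g + cross g f + ∑ i, f i * g i := by
  have h : cross g f = ∑ i, ∑ j, if i < j then f i * g j else 0 := by
    rw [cross, Finset.sum_comm]
    simp only [mul_comm]
  have hd : ∑ i, f i * g i = ∑ i, ∑ j, if i = j then f i * g j else 0 := by simp
  rw [h, hd, cross, Finset.sum_mul_sum]
  simp only [← Finset.sum_add_distrib]
  refine Finset.sum_congr rfl fun i _ => Finset.sum_congr rfl fun j _ => ?_
  rcases lt_trichotomy i j with h | h | h
  · simp [h, h.not_gt, h.ne]
  · simp [h]
  · simp [h, h.not_gt, h.ne']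

end Cross

/-! ### Indices in blocks -/

section Blocks

variable {r : ℕ} {s : Fin r → ℕ}

theorem sum_blocks {M : Type*} [AddCommMonoid M] (f : Fin (∑ i, s i) → M) :
    ∑ k, f k = ∑ i, ∑ j, f (finSigmaFinEquiv ⟨i, j⟩) := by
  rw [← Equiv.sum_comp finSigmaFinEquiv f, Fintype.sum_sigma]

theorem finSigmaFinEquiv_val_le (i i' : Fin r) (h : i < i') :
    ∑ t : Fin i, s (Fin.castLE i.2.le t) + s i ≤ ∑ t : Fin i', s (Fin.castLE i'.2.le t) := by
  have key : ∀ a : Fin r, ∑ t : Fin a, s (Fin.castLE a.2.le t) =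
      ∑ t ∈ Finset.range a, if ht : t < r then s ⟨t, ht⟩ else 0 := fun a => by
    rw [← Fin.sum_univ_eq_sum_range fun t => if ht : t < r then s ⟨t, ht⟩ else 0]
    refine Finset.sum_congr rfl fun t _ => ?_
    rw [dif_pos (t.2.trans a.2)]
    rfl
  have hi : s i = if ht : (i : ℕ) < r then s ⟨i, ht⟩ else 0 := by rw [dif_pos i.2]
  rw [key, key, hi, ← Finset.sum_range_succ fun t => if ht : t < r then s ⟨t, ht⟩ else 0]
  exact Finset.sum_le_sum_of_subset (Finset.range_mono h)

/-- The blocks follow each other in increasing order. -/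
theorem finSigmaFinEquiv_lt_iff (i i' : Fin r) (j : Fin (s i)) (j' : Fin (s i')) :
    (finSigmaFinEquiv ⟨i, j⟩ : Fin (∑ i, s i)) < finSigmaFinEquiv ⟨i', j'⟩ ↔
      i < i' ∨ ∃ h : i = i', h ▸ j < j' := by
  rw [Fin.lt_def, finSigmaFinEquiv_apply, finSigmaFinEquiv_apply]
  rcases lt_trichotomy i i' with h | rfl | h
  · have := finSigmaFinEquiv_val_le (s := s) i i' h
    have := j.2
    simp only [h, true_or, iff_true]
    omega
  · simp
  · have := finSigmaFinEquiv_val_le (s := s) i' i h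
    have := j'.2
    simp only [h.not_gt, h.ne', false_or, IsEmpty.exists_iff, iff_false]
    omega

/-- The pairs of indices of a family in blocks are pairs inside a block, or lie over a pair of
distinct blocks. -/
theorem cross_blocks {R : Type*} [CommRing R] (f g : Fin (∑ i, s i) → R) :
    cross f g = ∑ i, cross (fun j => f (finSigmaFinEquiv ⟨i, j⟩))
        (fun j => g (finSigmaFinEquiv ⟨i, j⟩)) +
      cross (fun i => ∑ j, f (finSigmaFinEquiv ⟨i, j⟩))
        fun i => ∑ j, g (finSigmaFinEquiv ⟨i, j⟩) := by
  simp only [cross]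
  rw [sum_blocks]
  simp only [sum_blocks (fun k => ite (k < _) _ _)]
  rw [← Finset.sum_add_distrib]
  refine Finset.sum_congr rfl fun i _ => ?_
  rw [Finset.sum_comm, Finset.sum_comm]
  have key : ∀ (j : Fin (s i)) (i' : Fin r),
      (∑ j' : Fin (s i'), if (finSigmaFinEquiv ⟨i', j'⟩ : Fin (∑ i, s i)) < finSigmaFinEquiv ⟨i, j⟩
        then f (finSigmaFinEquiv ⟨i, j⟩) * g (finSigmaFinEquiv ⟨i', j'⟩) else 0) =
      (if i' = i then ∑ j' : Fin (s i), if j' < j then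
        f (finSigmaFinEquiv ⟨i, j⟩) * g (finSigmaFinEquiv ⟨i, j'⟩) else 0 else 0) +
      if i' < i then f (finSigmaFinEquiv ⟨i, j⟩) * ∑ j', g (finSigmaFinEquiv ⟨i', j'⟩) else 0 := by
    intro j i'
    simp only [finSigmaFinEquiv_lt_iff]
    rcases lt_trichotomy i' i with h | rfl | h
    · simp [h, h.ne, Finset.mul_sum]
    · simp
    · simp [h.not_gt, h.ne']
  simp only [key, Finset.sum_add_distrib, Finset.sum_ite_eq', Finset.mem_univ, if_true]
  congr 1
  rw [Finset.sum_comm]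
  refine Finset.sum_congr rfl fun i' _ => ?_
  split_ifs
  · rw [Finset.sum_mul]
  · simp

end Blocks

/-! ### Chains of permutations -/

section Chains

variable (F : Type u) [Field F] {r : ℕ}

/-- The class of the simplex `(X 0, ..., X n)`. The vertices are given by a sequence, of which only
the first terms matter, so that the faces of a simplex have no degrees in their type which would
have to be transported. -/
def chain (X : ℕ → Equiv.Perm (Fin r)) (n : ℕ) : E F r n := cls F fun t : Fin (n + 1) => X t

/-- Consecutive vertices among `X 0, ..., X n` differ. -/
def Reduced (X : ℕ → Equiv.Perm (Fin r)) (n : ℕ) : Prop := ∀ t < n, X t ≠ X (t + 1)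

variable {F}

theorem Reduced.nondegenerate {X : ℕ → Equiv.Perm (Fin r)} {n : ℕ} (h : Reduced X n) :
    Simplex.Nondegenerate fun t : Fin (n + 1) => X t := fun j => h j j.2

theorem chain_of_reduced {X : ℕ → Equiv.Perm (Fin r)} {n : ℕ} (h : Reduced X n) :
    chain F X n = Finsupp.single ⟨_, h.nondegenerate⟩ 1 := dif_pos h.nondegenerate

theorem chain_eq_zero {X : ℕ → Equiv.Perm (Fin r)} {n t : ℕ} (ht : t < n) (h : X t = X (t + 1)) :
    chain F X n = 0 := dif_neg fun hX => hX ⟨t, ht⟩ h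

theorem chain_eq_zero_of_not_reduced {X : ℕ → Equiv.Perm (Fin r)} {n : ℕ} (h : ¬ Reduced X n) :
    chain F X n = 0 := by
  unfold Reduced at h
  push Not at h
  obtain ⟨t, ht, h⟩ := h
  exact chain_eq_zero ht h

theorem chain_congr {X Y : ℕ → Equiv.Perm (Fin r)} {n : ℕ} (h : ∀ t ≤ n, X t = Y t) :
    chain F X n = chain F Y n := by
  unfold chain
  congr 1
  funext t
  exact h t (Nat.lt_succ_iff.1 t.2)

theorem exists_vertices {n : ℕ} (x : NSimplex r n) :
    ∃ X : ℕ → Equiv.Perm (Fin r), Reduced X n ∧ x.1 = fun t : Fin (n + 1) => X t := by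
  have h : ∀ t : Fin (n + 1), x.1 t = x.1 ⟨min t n, by omega⟩ := fun t => by
    ext
    simp [Nat.lt_succ_iff.1 t.2]
  refine ⟨fun t => x.1 ⟨min t n, by omega⟩, fun t ht => ?_, funext h⟩
  have := x.2 ⟨t, ht⟩
  rw [h (Fin.castSucc _), h (Fin.succ _)] at this
  exact this

/-- The nondegenerate chains span `E(r)_n`. -/
theorem chain_induction {n : ℕ} {P : E F r n → Prop} (ρ : E F r n) (zero : P 0)
    (add : ∀ x y, P x → P y → P (x + y)) (smul : ∀ (k : F) x, P x → P (k • x))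
    (reduced : ∀ X, Reduced X n → P (chain F X n)) : P ρ := by
  induction ρ using Finsupp.induction_linear with
  | zero => exact zero
  | add x y hx hy => exact add x y hx hy
  | single x k =>
    obtain ⟨X, hX, hx⟩ := exists_vertices x
    have := smul k _ (reduced X hX)
    rw [chain_of_reduced hX, Finsupp.smul_single, smul_eq_mul, mul_one] at this
    obtain rfl : x = ⟨_, hX.nondegenerate⟩ := Subtype.ext hx
    exact this

/-- The formula for the diagonal also holds for degenerate simplices: a repeated vertex lies in the
front face or in the back face. -/
theorem diagonal_chain (X : ℕ → Equiv.Perm (Fin r)) (n : ℕ) (k : Fin (n + 1)) :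
    diagonal (chain F X n) k = chain F X k ⊗ₜ[F] chain F (fun t => X (k + t)) (n - k) := by
  by_cases h : Reduced X n
  · rw [chain_of_reduced h, diagonal, Finsupp.linearCombination_single, one_smul]
    rfl
  · rw [chain_eq_zero_of_not_reduced h, map_zero, Pi.zero_apply]
    unfold Reduced at h
    push Not at h
    obtain ⟨t, ht, h⟩ := h
    by_cases hk : t < k
    · rw [chain_eq_zero hk h, TensorProduct.zero_tmul]
    · have h' : X (k + (t - k)) = X (k + (t - k + 1)) := by
        rw [← add_assoc, Nat.add_sub_of_le (not_lt.1 hk), h]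
      rw [chain_eq_zero (t := t - k) (X := fun t => X (k + t)) (by omega) h',
        TensorProduct.tmul_zero]

theorem bd_chain {X : ℕ → Equiv.Perm (Fin r)} {n : ℕ} (h : Reduced X (n + 1)) :
    bd (chain F X (n + 1)) = ∑ i ∈ Finset.range (n + 2),
      (-1 : F) ^ i • chain F (fun t => X (if t < i then t else t + 1)) n := by
  rw [chain_of_reduced h, bd, Finsupp.linearCombination_single, one_smul,
    ← Fin.sum_univ_eq_sum_range
      fun i => (-1 : F) ^ i • chain F (fun t => X (if t < i then t else t + 1)) n]
  refine Finset.sum_congr rfl fun i _ => ?_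
  unfold chain
  congr 2
  funext t
  simp only [Fin.succAbove, Fin.lt_def, Fin.val_castSucc]
  split_ifs <;> rfl

theorem act_chain (w : Equiv.Perm (Fin r)) (X : ℕ → Equiv.Perm (Fin r)) (n : ℕ) :
    act w (chain F X n) = chain F (fun t => w * X t) n := by
  by_cases h : Reduced X n
  · rw [chain_of_reduced h, act, Finsupp.linearCombination_single, one_smul]
    rfl
  · rw [chain_eq_zero_of_not_reduced h, map_zero, chain_eq_zero_of_not_reduced]
    exact fun h' => h fun t ht e => h' t ht (congrArg (w * ·) e)

end Chains

/-! ### Shuffles as words -/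

section Words

variable {r : ℕ}

/-- The number of letters `j` of a word. -/
def total {N : ℕ} (c : Fin N → Fin (r + 1)) (j : Fin (r + 1)) : ℕ :=
  (Finset.univ.filter fun a => c a = j).card

/-- The number of letters `j` of a word before the time `t`. -/
def before {N : ℕ} (c : Fin N → Fin (r + 1)) (j : Fin (r + 1)) (t : ℕ) : ℕ :=
  (Finset.univ.filter fun a : Fin N => (a : ℕ) < t ∧ c a = j).card

/-- The words of length `N` with `n` letters `0` and `m i` letters `i`. -/
def shuffles (N n : ℕ) (m : Fin r → ℕ) : Finset (Fin N → Fin (r + 1)) :=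
  Finset.univ.filter fun c => total c 0 = n ∧ ∀ i : Fin r, total c i.succ = m i

/-- The signature of a word. -/
def wordSign (F : Type u) [Field F] {N : ℕ} (c : Fin N → Fin (r + 1)) : F :=
  (-1) ^ (Finset.univ.filter fun p : Fin N × Fin N => p.1 < p.2 ∧ c p.2 < c p.1).card

theorem mem_shuffles {N n : ℕ} {m : Fin r → ℕ} {c : Fin N → Fin (r + 1)} :
    c ∈ shuffles N n m ↔ total c 0 = n ∧ ∀ i : Fin r, total c i.succ = m i := by
  simp [shuffles]

theorem sum_total {N : ℕ} (c : Fin N → Fin (r + 1)) : ∑ j, total c j = N := by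
  have := Finset.card_eq_sum_card_fiberwise (s := Finset.univ) (t := Finset.univ) (f := c)
    fun _ _ => Finset.mem_coe.2 (Finset.mem_univ _)
  rw [Finset.card_univ, Fintype.card_fin] at this
  exact this.symm

theorem length_of_mem_shuffles {N n : ℕ} {m : Fin r → ℕ} {c : Fin N → Fin (r + 1)}
    (h : c ∈ shuffles N n m) : N = n + ∑ i, m i := by
  rw [mem_shuffles] at h
  rw [← sum_total c, Fin.sum_univ_succ, h.1]
  simp only [h.2]

variable {k l : ℕ} (c₁ : Fin k → Fin (r + 1)) (c₂ : Fin l → Fin (r + 1))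

theorem total_append (j : Fin (r + 1)) :
    total (Fin.append c₁ c₂) j = total c₁ j + total c₂ j := by
  simp only [total, Finset.card_filter, Fin.sum_univ_add, Fin.append_left, Fin.append_right]

theorem before_append_left (j : Fin (r + 1)) {t : ℕ} (ht : t ≤ k) :
    before (Fin.append c₁ c₂) j t = before c₁ j t := by
  simp only [before, Finset.card_filter, Fin.sum_univ_add, Fin.append_left, Fin.append_right,
    Fin.val_castAdd, Fin.val_natAdd]
  rw [add_eq_left]
  refine Finset.sum_eq_zero fun a _ => if_neg ?_
  omega

theorem before_append_right (j : Fin (r + 1)) (t : ℕ) :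
    before (Fin.append c₁ c₂) j (k + t) = total c₁ j + before c₂ j t := by
  simp only [before, total, Finset.card_filter, Fin.sum_univ_add, Fin.append_left,
    Fin.append_right, Fin.val_castAdd, Fin.val_natAdd, add_lt_add_iff_left]
  congr 1
  refine Finset.sum_congr rfl fun a _ => ?_
  have : (a : ℕ) < k + t := by omega
  simp [this]

/-- The inversions of a concatenated word are those of the two parts, and the pairs formed by
a letter of the first part and a smaller letter of the second part. -/
theorem wordSign_append (F : Type u) [Field F] :
    wordSign F (Fin.append c₁ c₂) = wordSign F c₁ * wordSign F c₂ *
      sgn F (cross (fun x => (total c₁ x : ℤ)) fun y => (total c₂ y : ℤ)) := by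
  have h : (∑ a, ∑ b, if c₂ b < c₁ a then 1 else 0 : ℕ) =
      ∑ x, ∑ y, if y < x then total c₁ x * total c₂ y else 0 := by
    have h1 : ∀ a b, (if c₂ b < c₁ a then 1 else 0 : ℕ) = ∑ x, ∑ y,
        if y < x then (if c₁ a = x then 1 else 0) * (if c₂ b = y then 1 else 0) else 0 := by
      intro a b
      rw [Finset.sum_eq_single (c₁ a), Finset.sum_eq_single (c₂ b)]
      · simp
      · intro y _ hy
        simp [hy.symm]
      · simp
      · intro x _ hx
        simp [hx.symm]
      · simp
    simp only [h1]
    refine (Finset.sum_congr rfl fun a _ => Finset.sum_comm).trans (Finset.sum_comm.trans ?_)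
    refine Finset.sum_congr rfl fun x _ => ?_
    refine (Finset.sum_congr rfl fun a _ => Finset.sum_comm).trans (Finset.sum_comm.trans ?_)
    refine Finset.sum_congr rfl fun y _ => ?_
    simp only [total, Finset.card_filter]
    split_ifs
    · rw [Finset.sum_mul_sum]
    · simp
  have hcross : cross (fun x => (total c₁ x : ℤ)) (fun y => (total c₂ y : ℤ)) =
      ((∑ a, ∑ b, if c₂ b < c₁ a then 1 else 0 : ℕ) : ℤ) := by
    rw [h]
    simp only [cross]
    push_cast
    rfl
  rw [hcross, sgn_natCast]
  simp only [wordSign, ← pow_add]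
  congr 1
  simp only [Finset.card_filter, Fintype.sum_prod_type, Fin.sum_univ_add, Fin.append_left,
    Fin.append_right, Finset.sum_add_distrib]
  have h1 : ∀ (a : Fin k) (b : Fin l), Fin.castAdd l a < Fin.natAdd k b := fun a b => by
    rw [Fin.lt_def]; simp only [Fin.val_castAdd, Fin.val_natAdd]; omega
  have h2 : ∀ (a : Fin k) (b : Fin l), ¬ Fin.natAdd k b < Fin.castAdd l a := fun a b =>
    (h1 a b).not_gt
  have h3 : ∀ a b : Fin k, Fin.castAdd l a < Fin.castAdd l b ↔ a < b := fun a b => Iff.rfl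
  have h4 : ∀ a b : Fin l, Fin.natAdd k a < Fin.natAdd k b ↔ a < b := fun a b => by simp
  simp only [h1, h2, h3, h4, true_and, false_and, if_false, Finset.sum_const_zero]
  ring

/-- A word with a cut is a pair of words. The numbers of letters in the first word are `p` and
the `q i`. -/
theorem sum_shuffles_cut {M : Type*} [AddCommMonoid M] (n : ℕ) (m : Fin r → ℕ)
    (T : ∀ k l, (Fin (k + l) → Fin (r + 1)) → M) :
    ∑ kl ∈ Finset.HasAntidiagonal.antidiagonal (n + ∑ i, m i), ∑ c ∈ shuffles (kl.1 + kl.2) n m, T kl.1 kl.2 c =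
      ∑ p ∈ Finset.range (n + 1), ∑ q ∈ Fintype.piFinset fun i => Finset.range (m i + 1),
        ∑ c₁ ∈ shuffles (p + ∑ i, q i) p q,
          ∑ c₂ ∈ shuffles ((n - p) + ∑ i, (m i - q i)) (n - p) fun i => m i - q i,
            T _ _ (Fin.append c₁ c₂) := by
  -- for words of fixed lengths `k` and `l`, the numbers `p` and `q i` are determined by `c₁`
  have h1 : ∀ k l : ℕ, ∑ c ∈ shuffles (k + l) n m, T k l c =
      ∑ p ∈ Finset.range (n + 1), ∑ q ∈ Fintype.piFinset fun i => Finset.range (m i + 1),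
        ∑ c₁ ∈ shuffles k p q, ∑ c₂ ∈ shuffles l (n - p) fun i => m i - q i,
          T k l (Fin.append c₁ c₂) := by
    intro k l
    rw [shuffles, Finset.sum_filter, ← Equiv.sum_comp (Fin.appendEquiv k l), Fintype.sum_prod_type]
    simp only [shuffles, Finset.sum_filter]
    refine Eq.trans ?_ ((Finset.sum_congr rfl fun p _ => Finset.sum_comm).trans
      Finset.sum_comm).symm
    refine Finset.sum_congr rfl fun c₁ _ => ?_
    have h2 : ∀ (p : ℕ) (q : Fin r → ℕ) (x : M),
        (if total c₁ 0 = p ∧ ∀ i : Fin r, total c₁ i.succ = q i then x else 0) =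
          if p = total c₁ 0 then if q = (fun i : Fin r => total c₁ i.succ) then x else 0 else 0 := by
      intro p q x
      simp only [funext_iff, ← ite_and, eq_comm]
    simp only [h2]
    have h3 : ∀ (p : ℕ) (g : (Fin r → ℕ) → M),
        (∑ q ∈ Fintype.piFinset fun i => Finset.range (m i + 1), if p = total c₁ 0 then
          if q = (fun i : Fin r => total c₁ i.succ) then g q else 0 else 0) =
        if p = total c₁ 0 then if (fun i : Fin r => total c₁ i.succ) ∈
          Fintype.piFinset (fun i => Finset.range (m i + 1)) then
            g (fun i : Fin r => total c₁ i.succ) else 0 else 0 := by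
      intro p g
      split_ifs with h h'
      · rw [Finset.sum_ite_eq', if_pos h']
      · rw [Finset.sum_ite_eq', if_neg h']
      · simp
    simp only [h3]
    rw [Finset.sum_ite_eq']
    by_cases hc : total c₁ 0 ≤ n ∧ ∀ i : Fin r, total c₁ i.succ ≤ m i
    · rw [if_pos (Finset.mem_range.2 (Nat.lt_succ_of_le hc.1)), if_pos (Fintype.mem_piFinset.2
        fun i => Finset.mem_range.2 (Nat.lt_succ_of_le (hc.2 i)))]
      refine Finset.sum_congr rfl fun c₂ _ => ?_
      refine if_congr ?_ rfl rfl
      change total (Fin.append c₁ c₂) 0 = n ∧ (∀ i : Fin r, total (Fin.append c₁ c₂) i.succ = m i) ↔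
        _
      simp only [total_append]
      refine and_congr ?_ (forall_congr' fun i => ?_)
      · have := hc.1
        omega
      · have := hc.2 i
        omega
    · have : (if total c₁ 0 ∈ Finset.range (n + 1) then
          if (fun i : Fin r => total c₁ i.succ) ∈ Fintype.piFinset
            (fun i => Finset.range (m i + 1)) then
          (∑ c₂ : Fin l → Fin (r + 1), if total c₂ 0 = n - total c₁ 0 ∧ ∀ i : Fin r,
            total c₂ i.succ = m i - total c₁ i.succ then T k l (Fin.append c₁ c₂) else 0)
            else 0 else 0) = 0 := by
        split_ifs with ha hb
        · refine absurd ⟨?_, fun i => ?_⟩ hc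
          · exact Nat.lt_succ_iff.1 (Finset.mem_range.1 ha)
          · exact Nat.lt_succ_iff.1 (Finset.mem_range.1 (Fintype.mem_piFinset.1 hb i))
        · rfl
        · rfl
      rw [this]
      refine Finset.sum_eq_zero fun c₂ _ => if_neg ?_
      change ¬ (total (Fin.append c₁ c₂) 0 = n ∧
        ∀ i : Fin r, total (Fin.append c₁ c₂) i.succ = m i)
      simp only [total_append]
      rintro ⟨ha, hb⟩
      exact hc ⟨by omega, fun i => by have := hb i; omega⟩
  simp only [h1]
  rw [Finset.sum_comm]
  refine Finset.sum_congr rfl fun p hp => ?_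
  rw [Finset.sum_comm]
  refine Finset.sum_congr rfl fun q hq => ?_
  -- conversely, the numbers of letters determine the lengths
  rw [Finset.sum_eq_single (p + ∑ i, q i, (n - p) + ∑ i, (m i - q i))]
  · rintro ⟨k, l⟩ hkl hne
    refine Finset.sum_eq_zero fun c₁ h₁ => Finset.sum_eq_zero fun c₂ h₂ => ?_
    exact absurd (Prod.ext (length_of_mem_shuffles h₁) (length_of_mem_shuffles h₂)) hne
  · intro h
    refine absurd (Finset.HasAntidiagonal.mem_antidiagonal.2 ?_) h
    have h1 : p ≤ n := Nat.lt_succ_iff.1 (Finset.mem_range.1 hp)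
    have h2 : ∑ i, q i + ∑ i, (m i - q i) = ∑ i, m i := by
      rw [← Finset.sum_add_distrib]
      refine Finset.sum_congr rfl fun i _ => Nat.add_sub_of_le ?_
      exact Nat.lt_succ_iff.1 (Finset.mem_range.1 (Fintype.mem_piFinset.1 hq i))
    simp only
    omega

end Words

/-! ### The composition product on chains -/

section Composites

variable {F : Type u} [Field F] {r : ℕ} {s : Fin r → ℕ}

/-- The vertices of the composite of `X` and the `Y i` along a word. -/
def path (X : ℕ → Equiv.Perm (Fin r)) (Y : ∀ i, ℕ → Equiv.Perm (Fin (s i))) {N : ℕ}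
    (c : Fin N → Fin (r + 1)) (t : ℕ) : Equiv.Perm (Fin (∑ i, s i)) :=
  subst (X (before c 0 t)) fun i => Y i (before c i.succ t)

theorem compSimplex_eq_sum (X : ℕ → Equiv.Perm (Fin r)) (Y : ∀ i, ℕ → Equiv.Perm (Fin (s i)))
    (n : ℕ) (m : Fin r → ℕ) :
    compSimplex F (fun t : Fin (n + 1) => X t) (fun i (t : Fin (m i + 1)) => Y i t) =
      ∑ c ∈ shuffles (n + ∑ i, m i) n m, wordSign F c • chain F (path X Y c) (n + ∑ i, m i) := by
  rw [compSimplex]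
  refine Finset.sum_bij (fun c _ => c.1) (fun c _ => mem_shuffles.2 c.2)
    (fun c _ c' _ h => Subtype.ext h) (fun c hc => ⟨⟨c, mem_shuffles.1 hc⟩, Finset.mem_univ _, rfl⟩)
    fun c _ => rfl

theorem comp_chain {X : ℕ → Equiv.Perm (Fin r)} {Y : ∀ i, ℕ → Equiv.Perm (Fin (s i))}
    {n : ℕ} {m : Fin r → ℕ} (hX : Reduced X n) (hY : ∀ i, Reduced (Y i) (m i)) :
    comp (chain F X n) (fun i => chain F (Y i) (m i)) =
      ∑ c ∈ shuffles (n + ∑ i, m i) n m, wordSign F c • chain F (path X Y c) (n + ∑ i, m i) := by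
  rw [← compSimplex_eq_sum, comp]
  refine (Finset.sum_eq_single ⟨_, hX.nondegenerate⟩ (fun x _ hx => ?_) (by simp)).trans
    ((Finset.sum_eq_single (fun i => ⟨_, (hY i).nondegenerate⟩) (fun y _ hy => ?_) (by simp)).trans
      ?_)
  · refine Finset.sum_eq_zero fun y _ => ?_
    rw [chain_of_reduced hX, Finsupp.single_eq_of_ne hx, zero_mul, zero_smul]
  · obtain ⟨i, hi⟩ := Function.ne_iff.1 hy
    rw [Finset.prod_eq_zero (Finset.mem_univ i), mul_zero, zero_smul]
    rw [chain_of_reduced (hY i), Finsupp.single_eq_of_ne hi]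
  · simp only [chain_of_reduced hX, chain_of_reduced (hY _), Finsupp.single_eq_same,
      Finset.prod_const_one, mul_one, one_smul]

variable (X : ℕ → Equiv.Perm (Fin r)) (Y : ∀ i, ℕ → Equiv.Perm (Fin (s i))) {k l : ℕ}

theorem chain_path_append_left (c₁ : Fin k → Fin (r + 1)) (c₂ : Fin l → Fin (r + 1)) :
    chain F (path X Y (Fin.append c₁ c₂)) k = chain F (path X Y c₁) k :=
  chain_congr fun t ht => by simp only [path, before_append_left c₁ c₂ _ ht]

theorem chain_path_append_right {p : ℕ} {q : Fin r → ℕ} {c₁ : Fin k → Fin (r + 1)}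
    (h : c₁ ∈ shuffles k p q) (c₂ : Fin l → Fin (r + 1)) :
    chain F (fun t => path X Y (Fin.append c₁ c₂) (k + t)) l =
      chain F (path (fun t => X (p + t)) (fun i t => Y i (q i + t)) c₂) l :=
  chain_congr fun t _ => by
    rw [mem_shuffles] at h
    simp only [path, before_append_right, h.1, h.2]

end Composites

/-! ### Evaluation of operations on homogeneous morphisms -/

section Evaluation

open CochainComplex.HomComplex

variable {F : Type u} [Field F] (K : DG F) (A : EAlgebra F)

/-- The linear form `x_1 ⊗ ... ⊗ x_r ↦ ± ρ(u_1(x_1), ..., u_r(x_r))` on `K^{⊗ r}`, restricted to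
the tensors whose image has degree `b`. The sign is that of the evaluation of
`u_1 ⊗ ... ⊗ u_r`. -/
def evalTensor {r p : ℕ} (d : Fin r → ℤ) (ρ : E F r p) (b : ℤ)
    (z : ∀ i, Cochain K A.cx (d i)) : TPow K r →ₗ[F] A.cx.X b :=
  DirectSum.toModule F (Fin r → ℤ) (A.cx.X b) fun D =>
    if h : b + p = ∑ i, (D i + d i) then
      koszul F d D • applyTensor K A.cx d D (A.op (fun i => D i + d i) b h ρ) z
    else 0

variable {K A}

theorem evalTensor_lof_tprod {r p : ℕ} {d : Fin r → ℤ} (ρ : E F r p) {b : ℤ}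
    (z : ∀ i, Cochain K A.cx (d i)) {D o : Fin r → ℤ} (ho : ∀ i, D i + d i = o i)
    (hb : b + p = ∑ i, o i) (x : ∀ i, K.X (D i)) :
    evalTensor K A d ρ b z (DirectSum.lof F _ _ D (PiTensorProduct.tprod F x)) =
      koszul F d D • A.op o b hb ρ fun i => ((z i).v (D i) (o i) (ho i)).hom (x i) := by
  obtain rfl : (fun i => D i + d i) = o := funext ho
  rw [evalTensor, DirectSum.toModule_lof, dif_pos hb, LinearMap.smul_apply, applyTensor_tprod]

theorem evalTensor_lof_of_ne {r p : ℕ} {d : Fin r → ℤ} (ρ : E F r p) {b : ℤ}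
    (z : ∀ i, Cochain K A.cx (d i)) {D : Fin r → ℤ} (hb : b + p ≠ ∑ i, (D i + d i))
    (t : ⨂[F] i, K.X (D i)) :
    evalTensor K A d ρ b z (DirectSum.lof F _ _ D t) = 0 := by
  rw [evalTensor, DirectSum.toModule_lof, dif_neg hb, LinearMap.zero_apply]

/-- Linear forms on `K^{⊗ r}` which agree on the tensors `x_1 ⊗ ... ⊗ x_r` are equal. -/
theorem TPow.hom_ext {r : ℕ} {N : Type*} [AddCommGroup N] [Module F N] {f g : TPow K r →ₗ[F] N}
    (h : ∀ (D : Fin r → ℤ) (x : ∀ i, K.X (D i)),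
      f (DirectSum.lof F (Fin r → ℤ) (fun d => ⨂[F] i, K.X (d i)) D (PiTensorProduct.tprod F x)) =
        g (DirectSum.lof F (Fin r → ℤ) (fun d => ⨂[F] i, K.X (d i)) D
          (PiTensorProduct.tprod F x))) : f = g := by
  apply DirectSum.linearMap_ext
  intro D
  apply PiTensorProduct.ext
  apply MultilinearMap.ext
  exact h D

theorem evalTensor_add {r p : ℕ} (d : Fin r → ℤ) (ρ σ : E F r p) (b : ℤ)
    (z : ∀ i, Cochain K A.cx (d i)) :
    evalTensor K A d (ρ + σ) b z = evalTensor K A d ρ b z + evalTensor K A d σ b z := by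
  apply TPow.hom_ext
  intro D x
  rw [LinearMap.add_apply]
  by_cases hb : b + p = ∑ i, (D i + d i)
  · simp only [evalTensor_lof_tprod _ _ (fun _ => rfl) hb, map_add, _root_.add_apply, smul_add]
  · simp only [evalTensor_lof_of_ne _ _ hb, add_zero]

end Evaluation

/-! ### The operations on `Hom_F(K, A)` -/

section Pairs

open CochainComplex.HomComplex

variable {F : Type u} [Field F] (K : ECoalgebra F) (A : EAlgebra F)

/-- The operation `± ρ₁ · (u_1 ⊗ ... ⊗ u_r) · ρ₂^*` of a pair of elements of degrees `p` and `q`,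
extended by zero to the degrees which do not match. -/
def pairing {r : ℕ} (d : Fin r → ℤ) (e : ℤ) (p q : ℕ) :
    E F r p →ₗ[F] E F r q →ₗ[F]
      MultilinearMap F (fun i => Cochain K.cx A.cx (d i)) (Cochain K.cx A.cx e) :=
  if h : e + (p + q : ℕ) = ∑ i, d i then pairOp K A d e h else 0

variable {K A}

theorem pairing_v {r p q : ℕ} {d : Fin r → ℤ} {e : ℤ} (h : e + (p + q : ℕ) = ∑ i, d i)
    (ρ₁ : E F r p) (ρ₂ : E F r q) (z : ∀ i, Cochain K.cx A.cx (d i)) (a b : ℤ) (hab : a + e = b)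
    (c : K.cx.X a) :
    ((pairing K A d e p q ρ₁ ρ₂ z).v a b hab).hom c =
      sgn F (q * ∑ i, d i) • evalTensor K.cx A d ρ₁ b z (K.co a ρ₂ c) := by
  rw [pairing, dif_pos h]
  refine (pairOpComponent_apply K A d e h ρ₁ ρ₂ a b hab z c).trans ?_
  rw [evalTensor, ← toModule_smul]
  congr 2
  funext D
  have hD : ∑ i, D i + q = a ↔ b + p = ∑ i, (D i + d i) := by
    rw [Finset.sum_add_distrib, ← h, ← hab]
    push_cast
    constructor <;> intro h <;> linarith
  by_cases hb : b + p = ∑ i, (D i + d i)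
  · rw [dif_pos hb, dif_pos (hD.2 hb), mul_smul]
  · rw [dif_neg hb, dif_neg (fun h => hb (hD.1 h)), smul_zero]

/-- The operation of a chain is the sum of the pairings of the parts of its cuts. -/
theorem homOp_chain {r n : ℕ} (d : Fin r → ℤ) (e : ℤ) (h : e + n = ∑ i, d i)
    (X : ℕ → Equiv.Perm (Fin r)) :
    homOp K A d e h (chain F X n) = ∑ kl ∈ Finset.HasAntidiagonal.antidiagonal n,
      pairing K A d e kl.1 kl.2 (chain F X kl.1) (chain F (fun t => X (kl.1 + t)) kl.2) := by
  rw [Finset.Nat.sum_antidiagonal_eq_sum_range_succ fun k l =>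
    pairing K A d e k l (chain F X k) (chain F (fun t => X (k + t)) l),
    ← Fin.sum_univ_eq_sum_range fun k =>
      pairing K A d e k (n - k) (chain F X k) (chain F (fun t => X (k + t)) (n - k)),
    homOp, LinearMap.sum_apply]
  refine Finset.sum_congr rfl fun k _ => ?_
  rw [LinearMap.comp_apply, LinearMap.comp_apply, LinearMap.proj_apply, diagonal_chain,
    TensorProduct.lift.tmul, pairing, dif_pos]

theorem cochain_hom_ext {e : ℤ} {y z : Cochain K.cx A.cx e}
    (h : ∀ (a b : ℤ) (hab : a + e = b) (c : K.cx.X a),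
      (y.v a b hab).hom c = (z.v a b hab).hom c) : y = z := by
  ext a b hab c
  exact h a b hab c

theorem add_v_hom {e : ℤ} (y z : Cochain K.cx A.cx e) (a b : ℤ) (hab : a + e = b) (c : K.cx.X a) :
    ((y + z).v a b hab).hom c = (y.v a b hab).hom c + (z.v a b hab).hom c := rfl

theorem smul_v_hom {e : ℤ} (k : F) (z : Cochain K.cx A.cx e) (a b : ℤ) (hab : a + e = b)
    (c : K.cx.X a) : ((k • z).v a b hab).hom c = k • (z.v a b hab).hom c := rfl

/-! #### The unit -/

theorem one_eq_chain : one F = chain F (fun _ => 1) 0 := rfl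

theorem homOp_one (e : ℤ) (h : e + (0 : ℕ) = ∑ _i : Fin 1, e) (z : Fin 1 → Cochain K.cx A.cx e) :
    homOp K A (fun _ => e) e h (one F) z = z 0 := by
  rw [one_eq_chain, homOp_chain, Finset.Nat.antidiagonal_zero, Finset.sum_singleton]
  refine cochain_hom_ext fun a b hab c => ?_
  rw [pairing_v h]
  have hb : b + (0 : ℕ) = ∑ _i : Fin 1, b := by simp
  change _ • evalTensor K.cx A _ (one F) b z (K.co a (one F) c) = _
  rw [K.co_one, evalTensor_lof_tprod (one F) z (fun _ => hab) hb, A.isEAlgebra.op_one]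
  simp [koszul, sgn_zero]

/-! #### The action of permutations -/

/-- The parity of the signs in the axiom for permutations: both sides count the pairs of indices
whose order is reversed by `w`. -/
theorem cross_perm {r : ℕ} (w : Equiv.Perm (Fin r)) (d D : Fin r → ZMod 2) :
    (∑ i, ∑ j, if i < j ∧ w j < w i then (D i + d (w i)) * (D j + d (w j)) else 0) +
      (∑ i, ∑ j, if i < j ∧ w j < w i then D i * D j else 0) +
      cross d (fun i => D (w.symm i)) =
    (∑ i, ∑ j, if i < j ∧ w j < w i then d (w i) * d (w j) else 0) + cross (fun i => d (w i)) D := by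
  have h1 : cross d (fun i => D (w.symm i)) =
      ∑ i, ∑ j, if w j < w i then d (w i) * D j else 0 := by
    rw [cross, ← Equiv.sum_comp w]
    refine Finset.sum_congr rfl fun i _ => ?_
    rw [← Equiv.sum_comp w]
    simp only [Equiv.symm_apply_apply]
  have h2 : (∑ i, ∑ j, if i < j ∧ w j < w i then D i * d (w j) else 0 : ZMod 2) =
      ∑ i, ∑ j, if j < i ∧ w i < w j then d (w i) * D j else 0 := by
    rw [Finset.sum_comm]
    simp only [mul_comm]
  have h3 : (∑ i, ∑ j, if i < j ∧ w j < w i then (D i + d (w i)) * (D j + d (w j)) else 0) =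
      (∑ i, ∑ j, if i < j ∧ w j < w i then D i * D j else 0) +
      (∑ i, ∑ j, if i < j ∧ w j < w i then D i * d (w j) else 0) +
      (∑ i, ∑ j, if i < j ∧ w j < w i then d (w i) * D j else 0) +
      (∑ i, ∑ j, if i < j ∧ w j < w i then d (w i) * d (w j) else 0) := by
    simp only [← Finset.sum_add_distrib]
    refine Finset.sum_congr rfl fun i _ => Finset.sum_congr rfl fun j _ => ?_
    split_ifs <;> ring
  have h4 : (∑ i, ∑ j, if j < i ∧ w i < w j then d (w i) * D j else 0) +
      (∑ i, ∑ j, if i < j ∧ w j < w i then d (w i) * D j else 0) +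
      (∑ i, ∑ j, if w j < w i then d (w i) * D j else 0) = cross (fun i => d (w i)) D := by
    simp only [cross, ← Finset.sum_add_distrib]
    refine Finset.sum_congr rfl fun i _ => Finset.sum_congr rfl fun j _ => ?_
    rcases lt_trichotomy i j with h | rfl | h
    · by_cases hw : w j < w i
      · simp [h, h.not_gt, hw, hw.not_gt, CharTwo.add_self_eq_zero]
      · simp [h, h.not_gt, hw]
    · simp
    · by_cases hw : w j < w i
      · simp [h, h.not_gt, hw, hw.not_gt]
      · have : w i < w j := lt_of_le_of_ne (not_lt.1 hw) (w.injective.ne h.ne')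
        simp [h, h.not_gt, hw, this]
  rw [h1, h3, h2, ← h4]
  linear_combination CharTwo.add_self_eq_zero
    (∑ i, ∑ j, if i < j ∧ w j < w i then D i * D j else 0 : ZMod 2)

theorem evalTensor_perm {r p : ℕ} (w : Equiv.Perm (Fin r)) (ρ : E F r p) (d : Fin r → ℤ) (b : ℤ)
    (z : ∀ i, Cochain K.cx A.cx (d i)) (t : TPow K.cx r) :
    evalTensor K.cx A d (act w ρ) b z (TPow.perm K.cx w t) =
      permSign F w (fun i => d (w i)) •
        evalTensor K.cx A (fun i => d (w i)) ρ b (fun i => z (w i)) t := by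
  rw [← LinearMap.comp_apply, ← LinearMap.smul_apply]
  congr 1
  apply TPow.hom_ext
  intro D x
  rw [LinearMap.comp_apply, LinearMap.smul_apply, TPow.perm, DirectSum.toModule_lof,
    LinearMap.smul_apply, LinearMap.comp_apply, map_smul]
  erw [PiTensorProduct.reindex_tprod]
  by_cases hb : b + p = ∑ i, (D i + d (w i))
  · have hb' : b + p = ∑ i, (D (w.symm i) + d i) := by
      rw [hb, ← Equiv.sum_comp w fun i => D (w.symm i) + d i]
      simp only [Equiv.symm_apply_apply]
    rw [evalTensor_lof_tprod _ _ (fun _ => rfl) hb', evalTensor_lof_tprod _ _ (fun _ => rfl) hb,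
      A.isEAlgebra.op_act, smul_smul, smul_smul, smul_smul]
    have aux : ∀ (o : Fin r → ℤ) (ho : ∀ i, D (w.symm (w i)) + d (w i) = o i)
        (hb : b + p = ∑ i, o i) (hb' : b + p = ∑ i, (D i + d (w i))),
        A.op o b hb ρ (fun i => ((z (w i)).v (D (w.symm (w i))) (o i) (ho i)).hom
          (x (w.symm (w i)))) =
        A.op (fun i => D i + d (w i)) b hb' ρ
          (fun i => ((z (w i)).v (D i) (D i + d (w i)) rfl).hom (x i)) := by
      intro o ho hb hb'
      obtain rfl : (fun i => D i + d (w i)) = o := funext fun i => by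
        rw [← ho, Equiv.symm_apply_apply]
      congr 1
      funext i
      have : ∀ (j : Fin r) (hj : j = i) (h : D j + d (w i) = D i + d (w i)),
          ((z (w i)).v (D j) (D i + d (w i)) h).hom (x j) =
            ((z (w i)).v (D i) (D i + d (w i)) rfl).hom (x i) := by
        rintro _ rfl _
        rfl
      exact this _ (w.symm_apply_apply i) _
    refine congrArg₂ (· • ·) ?_ (aux _ (fun _ => rfl) _ _)
    rw [mul_assoc]
    simp only [permSign, koszul, ← sgn_add]
    apply sgn_congr
    have := cross_perm w (fun i => (d i : ZMod 2)) fun i => (D i : ZMod 2)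
    simp only [cross] at this
    push_cast [Equiv.symm_apply_apply]
    rw [← this]
    ring
  · have hb' : b + p ≠ ∑ i, (D (w.symm i) + d i) := by
      rw [← Equiv.sum_comp w fun i => D (w.symm i) + d i]
      simpa only [Equiv.symm_apply_apply] using hb
    rw [evalTensor_lof_of_ne _ _ hb', evalTensor_lof_of_ne _ _ hb, smul_zero, smul_zero]

theorem pairing_act {r p q : ℕ} (w : Equiv.Perm (Fin r)) (ρ₁ : E F r p) (ρ₂ : E F r q)
    {d : Fin r → ℤ} {e : ℤ} (h : e + (p + q : ℕ) = ∑ i, d i)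
    (z : ∀ i, Cochain K.cx A.cx (d i)) :
    pairing K A d e p q (act w ρ₁) (act w ρ₂) z =
      permSign F w (fun i => d (w i)) •
        pairing K A (fun i => d (w i)) e p q ρ₁ ρ₂ fun i => z (w i) := by
  refine cochain_hom_ext fun a b hab c => ?_
  rw [smul_v_hom, pairing_v h, pairing_v (h.trans (Equiv.sum_comp w d).symm), K.co_act,
    evalTensor_perm, smul_comm, Equiv.sum_comp w d]

theorem homOp_act {r n : ℕ} (w : Equiv.Perm (Fin r)) (ρ : E F r n) (d : Fin r → ℤ) (e : ℤ)
    (h : e + n = ∑ i, d i) (z : ∀ i, Cochain K.cx A.cx (d i)) :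
    homOp K A d e h (act w ρ) z =
      permSign F w (fun i => d (w i)) •
        homOp K A (fun i => d (w i)) e (h.trans (Equiv.sum_comp w d).symm) ρ fun i => z (w i) := by
  induction ρ using chain_induction with
  | zero => simp
  | add x y hx hy => simp only [map_add, _root_.add_apply, hx, hy, smul_add]
  | smul k x hx => simp only [map_smul, _root_.smul_apply, hx, smul_comm k]
  | reduced X hX =>
    rw [act_chain, homOp_chain, homOp_chain, _root_.sum_apply, _root_.sum_apply, Finset.smul_sum]
    refine Finset.sum_congr rfl fun kl hkl => ?_
    rw [Finset.HasAntidiagonal.mem_antidiagonal] at hkl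
    rw [← act_chain, ← act_chain, pairing_act w _ _ (by rw [hkl, h])]

end Pairs

/-! ### Operations of composites on `Hom_F(K, A)` -/

section Composition

open CochainComplex.HomComplex

variable {F : Type u} [Field F] {A : EAlgebra F}

section Form

variable {K : DG F} {r p : ℕ} {s q : Fin r → ℕ}

variable (s) in
/-- The part of index `i` of a family which is indexed by the blocks `s 0, ..., s (r - 1)`. -/
abbrev block {M : Fin (∑ i, s i) → Type*} (x : ∀ k, M k) (i : Fin r) (j : Fin (s i)) :
    M (finSigmaFinEquiv ⟨i, j⟩) := x (finSigmaFinEquiv ⟨i, j⟩)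

/-- The linear form on `K^{⊗ s_1} ⊗ ... ⊗ K^{⊗ s_r}` which gives
`± ρ(σ_1(u_{11}(x_{11}), ...), ..., σ_r(u_{r1}(x_{r1}), ...))` on tensors. Its composite with
`TPow.nest` is the linear form `evalTensor` of the composite `ρ(σ_1, ..., σ_r)`. -/
def compForm (d : Fin (∑ i, s i) → ℤ) (ρ : E F r p) (σ : ∀ i, E F (s i) (q i)) (b : ℤ)
    (u : ∀ k, Cochain K A.cx (d k)) : (⨂[F] i, TPow K (s i)) →ₗ[F] A.cx.X b :=
  PiTensorProduct.lift <| MultilinearMap.fromDirectSumEquiv fun κ : ∀ i, Fin (s i) → ℤ =>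
    if hb : b + p = ∑ i, (∑ j, (κ i j + block s d i j) - q i) then
      sgn F (cross (fun i => ∑ j, block s d i j) (fun i => ∑ j, κ i j) +
        cross (fun i => (q i : ℤ)) fun i => ∑ j, (κ i j + block s d i j)) •
        (A.op (fun i => ∑ j, (κ i j + block s d i j) - q i) b hb ρ).compLinearMap fun i =>
          evalTensor K A (block s d i) (σ i) (∑ j, (κ i j + block s d i j) - q i) (block s u i) ∘ₗ
            DirectSum.lof F (Fin (s i) → ℤ) (fun d => ⨂[F] j, K.X (d j)) (κ i)
    else 0

theorem compForm_lof {d : Fin (∑ i, s i) → ℤ} (ρ : E F r p) (σ : ∀ i, E F (s i) (q i)) {b : ℤ}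
    (u : ∀ k, Cochain K A.cx (d k)) {κ : ∀ i, Fin (s i) → ℤ} {o : Fin r → ℤ}
    (ho : ∀ i, o i + q i = ∑ j, (κ i j + block s d i j)) (hb : b + p = ∑ i, o i)
    (y : ∀ i, ⨂[F] j, K.X (κ i j)) :
    compForm d ρ σ b u (PiTensorProduct.tprod F fun i => DirectSum.lof F _ _ (κ i) (y i)) =
      sgn F (cross (fun i => ∑ j, block s d i j) (fun i => ∑ j, κ i j) +
        cross (fun i => (q i : ℤ)) fun i => ∑ j, (κ i j + block s d i j)) •
        A.op o b hb ρ fun i => evalTensor K A (block s d i) (σ i) (o i) (block s u i)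
          (DirectSum.lof F _ _ (κ i) (y i)) := by
  obtain rfl : (fun i => ∑ j, (κ i j + block s d i j) - (q i : ℤ)) = o :=
    funext fun i => by rw [← ho]; ring
  rw [compForm, PiTensorProduct.lift.tprod, MultilinearMap.fromDirectSumEquiv_lof, dif_pos hb]
  rfl

theorem compForm_lof_of_ne {d : Fin (∑ i, s i) → ℤ} (ρ : E F r p) (σ : ∀ i, E F (s i) (q i))
    {b : ℤ} (u : ∀ k, Cochain K A.cx (d k)) {κ : ∀ i, Fin (s i) → ℤ} {o : Fin r → ℤ}
    (ho : ∀ i, o i + q i = ∑ j, (κ i j + block s d i j)) (hb : b + p ≠ ∑ i, o i)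
    (y : ∀ i, ⨂[F] j, K.X (κ i j)) :
    compForm d ρ σ b u (PiTensorProduct.tprod F fun i => DirectSum.lof F _ _ (κ i) (y i)) = 0 := by
  obtain rfl : (fun i => ∑ j, (κ i j + block s d i j) - (q i : ℤ)) = o :=
    funext fun i => by rw [← ho]; ring
  rw [compForm, PiTensorProduct.lift.tprod, MultilinearMap.fromDirectSumEquiv_lof, dif_neg hb]
  rfl

/-- The composition axiom of `A`, in terms of linear forms. -/
theorem compForm_nest (d : Fin (∑ i, s i) → ℤ) (ρ : E F r p) (σ : ∀ i, E F (s i) (q i)) (b : ℤ)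
    (u : ∀ k, Cochain K A.cx (d k)) (t : TPow K (∑ i, s i)) :
    compForm d ρ σ b u (TPow.nest K s t) = evalTensor K A d (comp ρ σ) b u t := by
  rw [← LinearMap.comp_apply]
  congr 1
  apply TPow.hom_ext
  intro D x
  rw [LinearMap.comp_apply, TPow.nest, DirectSum.toModule_lof, PiTensorProduct.lift.tprod]
  change compForm d ρ σ b u (PiTensorProduct.tprod F fun i => DirectSum.lof F _ _ (block s D i)
    (PiTensorProduct.tprod F fun j => block s x i j)) = _
  have ho : ∀ i, ∑ j, (block s D i j + block s d i j) - (q i : ℤ) + q i =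
    ∑ j, (block s D i j + block s d i j) := fun i => by ring
  have hiff : b + (p + ∑ i, q i : ℕ) = ∑ k, (D k + d k) ↔
      b + p = ∑ i, (∑ j, (block s D i j + block s d i j) - (q i : ℤ)) := by
    rw [sum_blocks, Finset.sum_sub_distrib]
    push_cast
    constructor <;> intro h <;> linarith
  by_cases hb : b + p = ∑ i, (∑ j, (block s D i j + block s d i j) - (q i : ℤ))
  · rw [compForm_lof ρ σ u ho hb, evalTensor_lof_tprod _ _ (fun _ => rfl) (hiff.2 hb),
      A.isEAlgebra.op_comp ρ σ _ _ b (hiff.2 hb) ho hb]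
    have := fun i => evalTensor_lof_tprod (A := A) (σ i) (block s u i) (D := block s D i)
      (fun _ => rfl) (ho i) (block s x i)
    simp only [this]
    rw [MultilinearMap.map_smul_univ, smul_smul, smul_smul]
    congr 1
    have hk : koszul F d D = (∏ i, koszul F (block s d i) (block s D i)) *
        sgn F (cross (fun i => ∑ j, block s d i j) (fun i => ∑ j, block s D i j)) := by
      change sgn F (cross d D) = (∏ i, sgn F (cross (block s d i) (block s D i))) * _
      rw [cross_blocks, sgn_add, prod_sgn]
    rw [hk, sgn_add]
    simp only [koszul, cross]
    ring
  · rw [compForm_lof_of_ne ρ σ u ho hb, evalTensor_lof_of_ne _ _ fun h => hb (hiff.1 h)]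

/-- The values of `compForm` on tensors `t_1 ⊗ ... ⊗ t_r` with homogeneous factors. -/
theorem compForm_tprod {d : Fin (∑ i, s i) → ℤ} (ρ : E F r p) (σ : ∀ i, E F (s i) (q i)) {b : ℤ}
    (u : ∀ k, Cochain K A.cx (d k)) {g o : Fin r → ℤ}
    (ho : ∀ i, o i + q i = g i + ∑ j, block s d i j) (hb : b + p = ∑ i, o i)
    (t : ∀ i, TPow K (s i)) (ht : ∀ i D, ∑ j, D j ≠ g i → t i D = 0) :
    compForm d ρ σ b u (PiTensorProduct.tprod F t) =
      sgn F (cross (fun i => ∑ j, block s d i j) g +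
        cross (fun i => (q i : ℤ)) fun i => g i + ∑ j, block s d i j) •
        A.op o b hb ρ fun i => evalTensor K A (block s d i) (σ i) (o i) (block s u i) (t i) := by
  classical
  have h : t = fun i => ∑ D ∈ DFinsupp.support (t i), DirectSum.lof F (Fin (s i) → ℤ)
      (fun d => ⨂[F] j, K.X (d j)) D (t i D) :=
    funext fun i => (DirectSum.sum_support_of (t i)).symm
  conv_lhs => rw [h]
  conv_rhs => rw [h]
  simp only [map_sum]
  rw [MultilinearMap.map_sum_finset, MultilinearMap.map_sum_finset, map_sum, Finset.smul_sum]
  refine Finset.sum_congr rfl fun κ hκ => ?_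
  have hg : ∀ i, ∑ j, κ i j = g i := fun i => by
    by_contra hne
    exact DFinsupp.mem_support_iff.1 (Fintype.mem_piFinset.1 hκ i) (ht i _ hne)
  rw [compForm_lof ρ σ u (fun i => by rw [ho, Finset.sum_add_distrib, hg]) hb]
  simp only [Finset.sum_add_distrib, hg]

theorem compForm_tprod_of_ne {d : Fin (∑ i, s i) → ℤ} (ρ : E F r p) (σ : ∀ i, E F (s i) (q i))
    {b : ℤ} (u : ∀ k, Cochain K A.cx (d k)) {g o : Fin r → ℤ}
    (ho : ∀ i, o i + q i = g i + ∑ j, block s d i j) (hb : b + p ≠ ∑ i, o i)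
    (t : ∀ i, TPow K (s i)) (ht : ∀ i D, ∑ j, D j ≠ g i → t i D = 0) :
    compForm d ρ σ b u (PiTensorProduct.tprod F t) = 0 := by
  classical
  have h : t = fun i => ∑ D ∈ DFinsupp.support (t i), DirectSum.lof F (Fin (s i) → ℤ)
      (fun d => ⨂[F] j, K.X (d j)) D (t i D) :=
    funext fun i => (DirectSum.sum_support_of (t i)).symm
  rw [h, MultilinearMap.map_sum_finset, map_sum]
  refine Finset.sum_eq_zero fun κ hκ => ?_
  have hg : ∀ i, ∑ j, κ i j = g i := fun i => by
    by_contra hne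
    exact DFinsupp.mem_support_iff.1 (Fintype.mem_piFinset.1 hκ i) (ht i _ hne)
  exact compForm_lof_of_ne ρ σ u (fun i => by rw [ho, Finset.sum_add_distrib, hg]) hb _

end Form

variable {K : ECoalgebra F} {r p p' : ℕ} {s q q' : Fin r → ℕ}

/-- The linear form of `ρ₁` with respect to the homogeneous morphisms `σ_i(u_{i1}, ...)` is, up to
sign, obtained from `compForm` by means of the co-operations. -/
theorem evalTensor_pairing (ρ₁ : E F r p) (σ₁ : ∀ i, E F (s i) (q i))
    (σ₂ : ∀ i, E F (s i) (q' i)) (d : Fin (∑ i, s i) → ℤ) (d' : Fin r → ℤ)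
    (hd : ∀ i, d' i + (q i + q' i : ℕ) = ∑ j, block s d i j) (b : ℤ)
    (u : ∀ k, Cochain K.cx A.cx (d k)) (t : TPow K.cx r) :
    evalTensor K.cx A d' ρ₁ b
        (fun i => pairing K A (block s d i) (d' i) (q i) (q' i) (σ₁ i) (σ₂ i) (block s u i)) t =
      sgn F (∑ i, q' i * ∑ j, block s d i j +
        cross (fun i => ∑ j, block s d i j) (fun i => (q' i : ℤ)) +
        cross (fun i => (q i : ℤ)) (fun i => (q' i : ℤ)) +
        cross (fun i => (q i : ℤ)) (fun i => ∑ j, block s d i j)) •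
      compForm d ρ₁ σ₁ b u (DirectSum.toModule F (Fin r → ℤ) (⨂[F] i, TPow K.cx (s i))
        (fun D => koszul F (fun i => q' i) D •
          PiTensorProduct.map fun i => K.co (D i) (σ₂ i)) t) := by
  rw [← LinearMap.comp_apply, ← LinearMap.smul_apply]
  congr 1
  apply TPow.hom_ext
  intro g x
  rw [LinearMap.smul_apply, LinearMap.comp_apply, DirectSum.toModule_lof, LinearMap.smul_apply,
    PiTensorProduct.map_tprod, map_smul]
  have ho : ∀ i, (g i + d' i) + (q i : ℤ) = (g i - q' i) + ∑ j, block s d i j := fun i => by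
    rw [← hd]
    push_cast
    ring
  have ht : ∀ (i : Fin r) (D : Fin (s i) → ℤ), ∑ j, D j ≠ g i - q' i →
      K.co (g i) (σ₂ i) (x i) D = 0 := fun i D hD =>
    K.co_degree (g i) (σ₂ i) (x i) D fun h => hD (by rw [← h]; ring)
  by_cases hb : b + p = ∑ i, (g i + d' i)
  · rw [compForm_tprod ρ₁ σ₁ u ho hb _ ht, evalTensor_lof_tprod _ _ (fun _ => rfl) hb]
    simp only [pairing_v (hd _)]
    rw [MultilinearMap.map_smul_univ, smul_smul, smul_smul, smul_smul]
    congr 1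
    change sgn F (cross d' g) * _ = _ * sgn F (cross _ _) * _
    rw [prod_sgn]
    simp only [← sgn_add]
    obtain rfl : d' = fun i => ∑ j, block s d i j - q i - q' i := funext fun i => by
      rw [← hd]
      push_cast
      ring
    simp only [cross_sub_left, cross_add_right, cross_sub_right]
    refine sgn_eq_of_eq_add_two_mul F (-(cross (fun i => (q i : ℤ)) (fun i => ∑ j, block s d i j) +
      cross (fun i => (q' i : ℤ)) g + cross (fun i => (q i : ℤ)) g)) ?_
    ring
  · rw [compForm_tprod_of_ne ρ₁ σ₁ u ho hb _ ht, evalTensor_lof_of_ne _ _ hb, smul_zero, smul_zero]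

/-- The pairing of composites. The sign is that of the permutation of the factors of
`(ρ₁ ⊗ ρ₂) ⊗ (σ₁ ⊗ σ₂) ⊗ ...`, together with the sign of the composition axiom. -/
theorem pairing_comp (ρ₁ : E F r p) (ρ₂ : E F r p') (σ₁ : ∀ i, E F (s i) (q i))
    (σ₂ : ∀ i, E F (s i) (q' i)) (d : Fin (∑ i, s i) → ℤ) (d' : Fin r → ℤ) (e : ℤ)
    (h : e + (p + p' : ℕ) = ∑ i, d' i)
    (hd : ∀ i, d' i + (q i + q' i : ℕ) = ∑ j, block s d i j)
    (u : ∀ k, Cochain K.cx A.cx (d k)) :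
    pairing K A d' e p p' ρ₁ ρ₂
        (fun i => pairing K A (block s d i) (d' i) (q i) (q' i) (σ₁ i) (σ₂ i) (block s u i)) =
      sgn F (p' * ∑ i, (q i : ℤ) + cross (fun i => (q i : ℤ)) (fun i => (q' i : ℤ)) +
        cross (fun i => (q i : ℤ) + q' i) (fun i => ∑ j, block s d i j)) •
      pairing K A d e (p + ∑ i, q i) (p' + ∑ i, q' i) (comp ρ₁ σ₁) (comp ρ₂ σ₂) u := by
  have hsum : e + ((p + ∑ i, q i) + (p' + ∑ i, q' i) : ℕ) = ∑ k, d k := by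
    have := Finset.sum_congr rfl fun i (_ : i ∈ Finset.univ) => hd i
    rw [Finset.sum_add_distrib, ← h] at this
    rw [sum_blocks]
    refine Eq.trans ?_ this
    push_cast [Finset.sum_add_distrib]
    ring
  refine cochain_hom_ext fun a b hab c => ?_
  rw [smul_v_hom, pairing_v h, pairing_v hsum, evalTensor_pairing _ _ _ _ _ hd, ← compForm_nest,
    K.co_comp, map_smul, smul_smul, smul_smul, smul_smul]
  congr 1
  simp only [← sgn_add]
  obtain rfl : d' = fun i => ∑ j, block s d i j - q i - q' i := funext fun i => by
    rw [← hd]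
    push_cast
    ring
  have key := sum_mul_sum_eq_cross (fun i => (q' i : ℤ)) fun i => ∑ j, block s d i j
  have hdd : ∑ k, d k = ∑ i, ∑ j, block s d i j := sum_blocks d
  rw [hdd]
  simp only [cross_add_left, Finset.sum_sub_distrib]
  refine sgn_eq_of_eq_add_two_mul F (∑ i, (q' i : ℤ) * ∑ j, block s d i j +
    cross (fun i => ∑ j, block s d i j) (fun i => (q' i : ℤ)) - p' * ∑ i, (q i : ℤ) -
    p' * ∑ i, (q' i : ℤ) - (∑ i, (q' i : ℤ)) * ∑ i, ∑ j, block s d i j) ?_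
  push_cast
  linear_combination key

end Composition

/-! ### The composition axiom for `Hom_F(K, A)` -/

section CompositionAxiom

open CochainComplex.HomComplex

variable {F : Type u} [Field F]

theorem Reduced.front {r : ℕ} {X : ℕ → Equiv.Perm (Fin r)} {n p : ℕ} (h : Reduced X n)
    (hp : p ≤ n) : Reduced X p := fun t ht => h t (ht.trans_le hp)

theorem Reduced.back {r : ℕ} {X : ℕ → Equiv.Perm (Fin r)} {n p q : ℕ} (h : Reduced X n)
    (hp : p + q ≤ n) : Reduced (fun t => X (p + t)) q := fun t ht => h (p + t) (by omega)

theorem cross_succ {R : Type*} [CommRing R] {r : ℕ} (f g : Fin (r + 1) → R) :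
    cross f g = (∑ i : Fin r, f i.succ) * g 0 + cross (fun i => f i.succ) fun i => g i.succ := by
  simp only [cross, Fin.sum_univ_succ (n := r), Fin.succ_lt_succ_iff, Fin.not_lt_zero, if_false,
    Fin.succ_pos, if_true, Finset.sum_const_zero, add_zero, zero_add, Finset.sum_add_distrib,
    Finset.sum_mul]

variable {K : ECoalgebra F} {A : EAlgebra F} {r n : ℕ} {s m : Fin r → ℕ}

/-- The diagonal is compatible with the composition product: the operation of a composite of
chains is a sum over the cuts of the chains. -/
theorem homOp_comp_chain {X : ℕ → Equiv.Perm (Fin r)} {Y : ∀ i, ℕ → Equiv.Perm (Fin (s i))}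
    (hX : Reduced X n) (hY : ∀ i, Reduced (Y i) (m i)) (d : Fin (∑ i, s i) → ℤ) (e : ℤ)
    (h : e + ((n + ∑ i, m i : ℕ) : ℤ) = ∑ k, d k) (u : ∀ k, Cochain K.cx A.cx (d k)) :
    homOp K A d e h (comp (chain F X n) fun i => chain F (Y i) (m i)) u =
      ∑ p ∈ Finset.range (n + 1), ∑ q ∈ Fintype.piFinset fun i => Finset.range (m i + 1),
        sgn F ((n - p : ℕ) * ∑ i, (q i : ℤ) +
          cross (fun i => (q i : ℤ)) (fun i => ((m i - q i : ℕ) : ℤ))) •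
        pairing K A d e (p + ∑ i, q i) ((n - p) + ∑ i, (m i - q i))
          (comp (chain F X p) fun i => chain F (Y i) (q i))
          (comp (chain F (fun t => X (p + t)) (n - p))
            fun i => chain F (fun t => Y i (q i + t)) (m i - q i)) u := by
  have h1 : homOp K A d e h (comp (chain F X n) fun i => chain F (Y i) (m i)) u =
      ∑ kl ∈ Finset.HasAntidiagonal.antidiagonal (n + ∑ i, m i),
        ∑ c ∈ shuffles (kl.1 + kl.2) n m, wordSign F c •
          pairing K A d e kl.1 kl.2 (chain F (path X Y c) kl.1)
            (chain F (fun t => path X Y c (kl.1 + t)) kl.2) u := by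
    rw [comp_chain hX hY]
    simp only [map_sum, map_smul, _root_.sum_apply, _root_.smul_apply, homOp_chain,
      Finset.smul_sum]
    rw [Finset.sum_comm]
    refine Finset.sum_congr rfl fun kl hkl => ?_
    rw [Finset.HasAntidiagonal.mem_antidiagonal] at hkl
    rw [← hkl]
  rw [h1, sum_shuffles_cut n m fun k l c => wordSign F c • pairing K A d e k l
    (chain F (path X Y c) k) (chain F (fun t => path X Y c (k + t)) l) u]
  refine Finset.sum_congr rfl fun p hp => Finset.sum_congr rfl fun q hq => ?_
  have hp : p ≤ n := Nat.lt_succ_iff.1 (Finset.mem_range.1 hp)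
  have hq : ∀ i, q i ≤ m i := fun i =>
    Nat.lt_succ_iff.1 (Finset.mem_range.1 (Fintype.mem_piFinset.1 hq i))
  rw [comp_chain (hX.front hp) fun i => (hY i).front (hq i),
    comp_chain (hX.back (Nat.add_sub_of_le hp).le)
      fun i => (hY i).back (Nat.add_sub_of_le (hq i)).le]
  simp only [map_sum, map_smul, LinearMap.sum_apply, LinearMap.smul_apply, _root_.sum_apply,
    _root_.smul_apply, Finset.smul_sum]
  rw [Finset.sum_comm]
  refine Finset.sum_congr rfl fun c₂ h₂ => Finset.sum_congr rfl fun c₁ h₁ => ?_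
  rw [chain_path_append_left, chain_path_append_right X Y h₁, wordSign_append, cross_succ]
  rw [mem_shuffles] at h₁ h₂
  simp only [h₁.2, h₂.1, h₂.2, smul_smul]
  congr 1
  rw [mul_comm (∑ i, (q i : ℤ))]
  ring

theorem homOp_comp (ρ : E F r n) (σ : ∀ i, E F (s i) (m i))
    (d : Fin (∑ i, s i) → ℤ) (d' : Fin r → ℤ) (e : ℤ)
    (h : e + ((n + ∑ i, m i : ℕ) : ℤ) = ∑ k, d k)
    (h' : ∀ i, d' i + m i = ∑ j, d (finSigmaFinEquiv ⟨i, j⟩)) (h'' : e + n = ∑ i, d' i)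
    (u : ∀ k, Cochain K.cx A.cx (d k)) :
    homOp K A d e h (comp ρ σ) u =
      koszul F (fun i => m i) (fun i => ∑ j, d (finSigmaFinEquiv ⟨i, j⟩)) •
        homOp K A d' e h'' ρ fun i =>
          homOp K A (fun j => d (finSigmaFinEquiv ⟨i, j⟩)) (d' i) (h' i) (σ i)
            fun j => u (finSigmaFinEquiv ⟨i, j⟩) := by
  have hred : ∀ (X : ℕ → Equiv.Perm (Fin r)) (Y : ∀ i, ℕ → Equiv.Perm (Fin (s i))),
      Reduced X n → (∀ i, Reduced (Y i) (m i)) →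
      homOp K A d e h (comp (chain F X n) fun i => chain F (Y i) (m i)) u =
      koszul F (fun i => m i) (fun i => ∑ j, d (finSigmaFinEquiv ⟨i, j⟩)) •
        homOp K A d' e h'' (chain F X n) fun i =>
          homOp K A (fun j => d (finSigmaFinEquiv ⟨i, j⟩)) (d' i) (h' i) (chain F (Y i) (m i))
            fun j => u (finSigmaFinEquiv ⟨i, j⟩) := by
    intro X Y hX hY
    rw [homOp_comp_chain hX hY]
    simp only [homOp_chain]
    have hrange : ∀ (N : ℕ) {M : Type u} [AddCommGroup M] (f : ℕ → ℕ → M),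
        ∑ kl ∈ Finset.HasAntidiagonal.antidiagonal N, f kl.1 kl.2 =
          ∑ k ∈ Finset.range (N + 1), f k (N - k) := fun N M _ f =>
      Finset.Nat.sum_antidiagonal_eq_sum_range_succ f N
    rw [_root_.sum_apply, hrange n fun k l => pairing K A d' e k l (chain F X k)
      (chain F (fun t => X (k + t)) l) _, Finset.smul_sum]
    refine Finset.sum_congr rfl fun p hp => ?_
    have hp : p ≤ n := Nat.lt_succ_iff.1 (Finset.mem_range.1 hp)
    simp only [_root_.sum_apply]
    have := fun i => hrange (m i) fun k l => pairing K A (fun j => d (finSigmaFinEquiv ⟨i, j⟩))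
      (d' i) k l (chain F (Y i) k) (chain F (fun t => Y i (k + t)) l)
      fun j => u (finSigmaFinEquiv ⟨i, j⟩)
    simp only [this]
    rw [MultilinearMap.map_sum_finset, Finset.smul_sum]
    refine Finset.sum_congr rfl fun q hq => ?_
    have hq : ∀ i, q i ≤ m i := fun i =>
      Nat.lt_succ_iff.1 (Finset.mem_range.1 (Fintype.mem_piFinset.1 hq i))
    rw [pairing_comp _ _ _ _ d d' e (by rw [Nat.add_sub_of_le hp, h''])
      (fun i => by rw [Nat.add_sub_of_le (hq i), h']) u, smul_smul]
    congr 1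
    have hm : ∀ i, (q i : ℤ) + ((m i - q i : ℕ) : ℤ) = m i := fun i => by
      rw [← Nat.cast_add, Nat.add_sub_of_le (hq i)]
    simp only [hm]
    change _ = sgn F (cross _ _) * _
    rw [sgn_add F (_ + _), mul_left_comm, sgn_mul_self, mul_one]
  -- both sides are expanded in the bases of nondegenerate simplices
  have hsum : ∀ {r n : ℕ} (ρ : E F r n), ρ = ∑ x : NSimplex r n, ρ x • cls F x.1 := fun ρ => by
    conv_lhs => rw [← Finsupp.univ_sum_single ρ]
    refine Finset.sum_congr rfl fun x _ => ?_
    rw [cls, dif_pos x.2, Finsupp.smul_single, smul_eq_mul, mul_one]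
  have hcls : ∀ (x : NSimplex r n) (y : ∀ i, NSimplex (s i) (m i)),
      homOp K A d e h (compSimplex F x.1 fun i => (y i).1) u =
      koszul F (fun i => m i) (fun i => ∑ j, d (finSigmaFinEquiv ⟨i, j⟩)) •
        homOp K A d' e h'' (cls F x.1) fun i =>
          homOp K A (fun j => d (finSigmaFinEquiv ⟨i, j⟩)) (d' i) (h' i) (cls F (y i).1)
            fun j => u (finSigmaFinEquiv ⟨i, j⟩) := by
    intro x y
    obtain ⟨X, hX, hx⟩ := exists_vertices x
    choose Y hY hy using fun i => exists_vertices (y i)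
    rw [hx]
    simp only [hy]
    rw [compSimplex_eq_sum, ← comp_chain hX hY]
    exact hred X Y hX hY
  rw [comp]
  conv_rhs => rw [hsum ρ]
  conv_rhs =>
    enter [2, 2, i]
    rw [hsum (σ i)]
  simp only [map_sum, map_smul, _root_.sum_apply, _root_.smul_apply, hcls, Finset.smul_sum]
  refine Finset.sum_congr rfl fun x _ => ?_
  rw [MultilinearMap.map_sum, Finset.smul_sum, Finset.smul_sum]
  refine Finset.sum_congr rfl fun y _ => ?_
  rw [MultilinearMap.map_smul_univ, mul_smul, smul_comm (koszul F _ _), smul_comm (koszul F _ _)]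

end CompositionAxiom

/-! ### The differential of `Hom_F(K, A)` -/

section Boundary

variable {F : Type u} [Field F] {r : ℕ}

/-- The differential of `E(r)`, extended by zero to the degree zero. -/
def bdry : ∀ {n : ℕ}, E F r n →ₗ[F] E F r (n - 1)
  | 0 => 0
  | _ + 1 => bd

theorem cross_ind_left {R : Type*} [CommRing R] (i : Fin r) (g : Fin r → R) :
    cross (fun j => if j = i then 1 else 0) g = ∑ j, if j < i then g j else 0 := by
  rw [cross, Finset.sum_eq_single i]
  · simp
  · intro j _ hj
    simp [hj]
  · simp

theorem cross_ind_right {R : Type*} [CommRing R] (f : Fin r → R) (i : Fin r) :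
    cross f (fun j => if j = i then 1 else 0) = ∑ j, if i < j then f j else 0 := by
  rw [cross]
  refine Finset.sum_congr rfl fun j _ => ?_
  rw [Finset.sum_eq_single i]
  · simp
  · intro k _ hk
    simp [hk]
  · simp

theorem bump_eq (d : Fin r → ℤ) (i : Fin r) : bump d i = fun j => d j + if j = i then 1 else 0 := by
  funext j
  by_cases h : j = i
  · subst h
    simp
  · simp [h]

theorem koszul_bump_left (d D : Fin r → ℤ) (i : Fin r) :
    koszul F (bump d i) D = koszul F d D * sgn F (∑ j, if j < i then D j else 0) := by
  change sgn F (cross _ _) = sgn F (cross _ _) * _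
  rw [bump_eq, cross_add_left, cross_ind_left, sgn_add]

theorem koszul_bump_right (d D : Fin r → ℤ) (i : Fin r) :
    koszul F d (bump D i) = koszul F d D * sgn F (∑ j, if i < j then d j else 0) := by
  change sgn F (cross _ _) = sgn F (cross _ _) * _
  rw [bump_eq, cross_add_right, cross_ind_right, sgn_add]

end Boundary

section Differential

open CochainComplex.HomComplex

variable {F : Type u} [Field F]

/-! #### The differential of a homogeneous morphism in one factor -/

/-- The map `slot` for the dg-module `Hom_F(K, A)`, as a map between modules of cochains. -/
def slotCochain {K A : DG F} {r : ℕ} (d : Fin r → ℤ) (i j : Fin r) (z : Cochain K A (d j)) :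
    Cochain K A (bump d i j) := slot (homComplex K A) d i j z

theorem slotCochain_v {K A : DG F} {r : ℕ} (d : Fin r → ℤ) {i j : Fin r} (hj : j ≠ i)
    (z : Cochain K A (d j)) {p q : ℤ} (h : p + bump d i j = q) (h' : p + d j = q) :
    (slotCochain d i j z).v p q h = z.v p q h' := by
  have aux : ∀ {n m : ℤ} (e : n = m) (z : Cochain K A n) (h : p + m = q) (h' : p + n = q),
      Cochain.v (((homComplex K A).XIsoOfEq e).hom.hom z : Cochain K A m) p q h = z.v p q h' := by
    rintro n _ rfl z h h'
    simp
    rfl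
  rw [slotCochain, slot, dif_neg hj]
  exact aux _ z h h'

theorem v_slot_source {K A : DG F} {r : ℕ} (D : Fin r → ℤ) {i j : Fin r} (hj : j ≠ i) {n : ℤ}
    (z : Cochain K A n) {q : ℤ} (h : bump D i j + n = q) (h' : D j + n = q) (x : K.X (D j)) :
    (z.v (bump D i j) q h).hom (slot K D i j x) = (z.v (D j) q h').hom x := by
  have aux : ∀ {a b : ℤ} (e : a = b) (h : b + n = q) (h' : a + n = q) (x : K.X a),
      (z.v b q h).hom ((K.XIsoOfEq e).hom.hom x) = (z.v a q h').hom x := by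
    rintro a _ rfl h h' x
    simp
  rw [slot, dif_neg hj]
  exact aux _ h h' x

theorem slot_v_target {K A : DG F} {r : ℕ} (o : Fin r → ℤ) {i j : Fin r} (hj : j ≠ i) {n p : ℤ}
    (z : Cochain K A n) (h : p + n = o j) (h' : p + n = bump o i j) (x : K.X p) :
    slot A o i j ((z.v p (o j) h).hom x) = (z.v p (bump o i j) h').hom x := by
  have aux : ∀ {a b : ℤ} (e : a = b) (h : p + n = a) (h' : p + n = b),
      (A.XIsoOfEq e).hom.hom ((z.v p a h).hom x) = (z.v p b h').hom x := by
    rintro a _ rfl h h'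
    simp
  rw [slot, dif_neg hj]
  exact aux _ h h'

theorem slot_self (V : DG F) {r : ℕ} (d : Fin r → ℤ) (i : Fin r) (x : V.X (d i)) :
    slot V d i i x = (V.d (d i) (bump d i i)).hom x := by
  rw [slot, dif_pos rfl]

/-- The derivation rule `δ(u(x)) = (δ u)(x) ± u(δ x)` in the factor of index `i`. -/
theorem d_v {K A : DG F} {n m a a' b b' : ℤ} (hm : n + 1 = m) (ha : a + 1 = a') (hb : b + 1 = b')
    (z : Cochain K A n) (h₁ : a + n = b) (h₂ : a + m = b') (h₃ : a' + n = b') (x : K.X a) :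
    (A.d b b').hom ((z.v a b h₁).hom x) =
      ((δ n m z).v a b' h₂).hom x + sgn F n • (z.v a' b' h₃).hom ((K.d a a').hom x) := by
  subst hm
  rw [δ_v n _ rfl z a b' h₂ b a' (by omega) ha, Int.negOnePow_succ]
  rcases Int.even_or_odd n with hn | hn
  · simp [sgn, Int.negOnePow_even n hn]
  · simp [sgn, Int.negOnePow_odd n hn]

variable {K : DG F} {A : EAlgebra F} {r p : ℕ}

/-- The derivation rule `δ(u_i(x_i)) = (δ u_i)(x_i) ± u_i(δ x_i)` inside an operation. -/
theorem op_slot {d D o : Fin r → ℤ} (ho : ∀ j, D j + d j = o j) {b : ℤ} (ρ : E F r p) (i : Fin r)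
    (hb : b + p = ∑ j, bump o i j) (z : ∀ j, Cochain K A.cx (d j)) (x : ∀ j, K.X (D j))
    (h₁ : ∀ j, D j + bump d i j = bump o i j) (h₂ : ∀ j, bump D i j + d j = bump o i j) :
    A.op (bump o i) b hb ρ (fun j => slot A.cx o i j (((z j).v (D j) (o j) (ho j)).hom (x j))) =
      A.op (bump o i) b hb ρ (fun j => ((slotCochain d i j (z j)).v (D j)
        (bump o i j) (h₁ j)).hom (x j)) +
      sgn F (d i) • A.op (bump o i) b hb ρ
        (fun j => ((z j).v (bump D i j) (bump o i j) (h₂ j)).hom (slot K D i j (x j))) := by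
  have hdi := d_v (m := bump d i i) (a' := bump D i i) (b' := bump o i i) (by simp) (by simp)
    (by simp) (z i) (ho i) (h₁ i) (h₂ i) (x i)
  have e1 : (fun j => ((slotCochain d i j (z j)).v (D j) (bump o i j) (h₁ j)).hom (x j)) =
      Function.update
        (fun j => slot A.cx o i j (((z j).v (D j) (o j) (ho j)).hom (x j))) i
        (((δ (d i) (bump d i i) (z i)).v (D i) (bump o i i) (h₁ i)).hom (x i)) := by
    funext j
    by_cases hj : j = i
    · subst hj
      rw [Function.update_self]
      congr 3
      exact slot_self (homComplex K A.cx) d j (z j)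
    · have h : D j + d j = bump o i j := by rw [ho, bump, Function.update_of_ne hj]
      rw [Function.update_of_ne hj, slot_v_target o hj (z j) _ h, slotCochain_v d hj (z j) _ h]
  have e2 : (fun j => ((z j).v (bump D i j) (bump o i j) (h₂ j)).hom (slot K D i j (x j))) =
      Function.update
        (fun j => slot A.cx o i j (((z j).v (D j) (o j) (ho j)).hom (x j))) i
        (((z i).v (bump D i i) (bump o i i) (h₂ i)).hom ((K.d (D i) (bump D i i)).hom (x i))) := by
    funext j
    by_cases hj : j = i
    · subst hj
      rw [Function.update_self, slot_self]
    · have h : D j + d j = bump o i j := by rw [ho, bump, Function.update_of_ne hj]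
      rw [Function.update_of_ne hj, slot_v_target o hj (z j) _ h, v_slot_source D hj (z j) _ h]
  have e3 : (fun j => slot A.cx o i j (((z j).v (D j) (o j) (ho j)).hom (x j))) =
      Function.update
        (fun j => slot A.cx o i j (((z j).v (D j) (o j) (ho j)).hom (x j))) i
        ((A.cx.d (o i) (bump o i i)).hom (((z i).v (D i) (o i) (ho i)).hom (x i))) := by
    rw [← slot_self A.cx o i, Function.update_eq_self]
  rw [e1, e2]
  conv_lhs => rw [e3]
  rw [hdi, MultilinearMap.map_update_add, MultilinearMap.map_update_smul]

/-- The derivation rule for the operations of an algebra, for `ρ` of any degree. -/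
theorem op_diff (ρ : E F r p) (o : Fin r → ℤ) (b : ℤ) (h : b + p = ∑ i, o i)
    (a : ∀ i, A.cx.X (o i)) :
    (A.cx.d b (b + 1)).hom (A.op o b h ρ a) =
      (if h' : b + 1 + (p - 1 : ℕ) = ∑ i, o i then A.op o (b + 1) h' (bdry ρ) a else 0) +
      ∑ i, sgn F (p + ∑ j, if j < i then o j else 0) •
        A.op (bump o i) (b + 1) (by rw [sum_bump, ← h]; ring) ρ fun j => slot A.cx o i j (a j) := by
  cases p with
  | zero =>
    refine (A.isEAlgebra.op_diff_zero ρ o b h a).trans ?_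
    have : (if h' : b + 1 + (0 - 1 : ℕ) = ∑ i, o i then A.op o (b + 1) h' (bdry ρ) a else 0) =
        0 := by
      split_ifs
      · simp [bdry]
      · rfl
    rw [this, zero_add]
    simp only [Nat.cast_zero, zero_add]
  | succ p =>
    refine (A.isEAlgebra.op_diff_succ ρ o b h a).trans ?_
    rw [dif_pos (by rw [← h, Nat.add_sub_cancel]; push_cast; ring)]
    rfl

/-- The derivation rule for `x ↦ ± ρ(u_1(x_1), ..., u_r(x_r))`: the differential of the value is
distributed over `ρ`, the `u_i` and the tensor `x`. -/
theorem evalTensor_diff (d : Fin r → ℤ) (ρ : E F r p) (b : ℤ) (z : ∀ i, Cochain K A.cx (d i))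
    (t : TPow K r) :
    (A.cx.d b (b + 1)).hom (evalTensor K A d ρ b z t) =
      evalTensor K A d (bdry ρ) (b + 1) z t +
      ∑ i, sgn F (p + ∑ j, if j < i then d j else 0) •
        evalTensor K A (bump d i) ρ (b + 1) (fun j => slotCochain d i j (z j)) t +
      sgn F (p + ∑ i, d i) • evalTensor K A d ρ (b + 1) z (TPow.diff K r t) := by
  have hlin : (A.cx.d b (b + 1)).hom ∘ₗ evalTensor K A d ρ b z =
      evalTensor K A d (bdry ρ) (b + 1) z +
      ∑ i, sgn F (p + ∑ j, if j < i then d j else 0) •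
        evalTensor K A (bump d i) ρ (b + 1) (fun j => slotCochain d i j (z j)) +
      sgn F (p + ∑ i, d i) • evalTensor K A d ρ (b + 1) z ∘ₗ TPow.diff K r := by
    apply TPow.hom_ext
    intro D x
    simp only [LinearMap.add_apply, LinearMap.sum_apply, LinearMap.smul_apply,
      LinearMap.comp_apply]
    rw [TPow.diff, DirectSum.toModule_lof, LinearMap.sum_apply, map_sum]
    simp only [LinearMap.smul_apply, LinearMap.comp_apply, PiTensorProduct.map_tprod, map_smul]
    have h₁ : ∀ i j, D j + bump d i j = bump (fun j => D j + d j) i j := fun i j => by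
      simp only [bump_eq]
      ring
    have h₂ : ∀ i j, bump D i j + d j = bump (fun j => D j + d j) i j := fun i j => by
      simp only [bump_eq]
      ring
    by_cases hb : b + p = ∑ i, (D i + d i)
    · have hb' : ∀ i, b + 1 + p = ∑ j, bump (fun j => D j + d j) i j := fun i => by
        rw [sum_bump, ← hb]
        ring
      rw [evalTensor_lof_tprod _ _ (fun _ => rfl) hb, map_smul, op_diff]
      simp only [evalTensor_lof_tprod _ _ (h₁ _) (hb' _), evalTensor_lof_tprod _ _ (h₂ _) (hb' _)]
      simp only [op_slot (fun _ => rfl) ρ _ _ z x (h₁ _) (h₂ _)]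
      have hbd : evalTensor K A d (bdry ρ) (b + 1) z
          (DirectSum.lof F _ _ D (PiTensorProduct.tprod F x)) = koszul F d D •
          (if h' : b + 1 + (p - 1 : ℕ) = ∑ i, (D i + d i) then A.op _ (b + 1) h' (bdry ρ)
            (fun i => ((z i).v (D i) (D i + d i) rfl).hom (x i)) else 0) := by
        split_ifs with h'
        · rw [evalTensor_lof_tprod _ _ (fun _ => rfl) h']
        · rw [evalTensor_lof_of_ne _ _ h', smul_zero]
      rw [hbd]
      refine (smul_add _ _ _).trans (Eq.trans ?_ (add_assoc _ _ _).symm)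
      congr 1
      rw [Finset.smul_sum, Finset.smul_sum, ← Finset.sum_add_distrib]
      refine Finset.sum_congr rfl fun i _ => ?_
      rw [smul_add, smul_add, smul_smul, smul_smul, smul_smul, smul_smul, smul_smul, smul_smul,
        koszul_bump_left, koszul_bump_right]
      have hsplit : (∑ j, if j < i then D j + d j else 0) =
          (∑ j, if j < i then D j else 0) + ∑ j, if j < i then d j else 0 := by
        rw [← Finset.sum_add_distrib]
        refine Finset.sum_congr rfl fun j _ => ?_
        split_ifs <;> ring
      have hsum : ∑ j, d j =
          (∑ j, if j < i then d j else 0) + d i + ∑ j, if i < j then d j else 0 := by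
        have hi : d i = ∑ j, if j = i then d j else 0 := by simp
        conv_rhs => rw [hi]
        rw [← Finset.sum_add_distrib, ← Finset.sum_add_distrib]
        refine Finset.sum_congr rfl fun j _ => ?_
        rcases lt_trichotomy j i with h | h | h
        · simp [h, h.ne, h.not_gt]
        · simp [h]
        · simp [h, h.ne', h.not_gt]
      congr 2
      · rw [hsplit, sgn_add, sgn_add, sgn_add]
        ring
      · simp only [koszul, ← sgn_add]
        rw [hsplit, hsum]
        refine sgn_eq_of_eq_add_two_mul F (-∑ j, if i < j then d j else 0) ?_
        ring
    · have hb' : ∀ (D' d' : Fin r → ℤ), ∑ i, (D' i + d' i) = ∑ i, (D i + d i) + 1 →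
          b + 1 + p ≠ ∑ i, (D' i + d' i) := fun D' d' h h' => hb (by rw [h] at h'; linarith)
      rw [evalTensor_lof_of_ne _ _ hb, map_zero]
      have h₁' : ∀ i, ∑ j, (D j + bump d i j) = ∑ j, (D j + d j) + 1 := fun i => by
        simp only [h₁, sum_bump]
      have h₂' : ∀ i, ∑ j, (bump D i j + d j) = ∑ j, (D j + d j) + 1 := fun i => by
        simp only [h₂, sum_bump]
      simp only [evalTensor_lof_of_ne _ _ (hb' _ _ (h₁' _)),
        evalTensor_lof_of_ne _ _ (hb' _ _ (h₂' _)), smul_zero, Finset.sum_const_zero, add_zero]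
      cases p with
      | zero =>
        by_cases hc : b + 1 + (0 - 1 : ℕ) = ∑ i, (D i + d i)
        · rw [evalTensor_lof_tprod _ _ (fun _ => rfl) hc]
          simp [bdry]
        · rw [evalTensor_lof_of_ne _ _ hc]
      | succ p =>
        rw [evalTensor_lof_of_ne]
        intro h
        exact hb (by rw [← h, Nat.add_sub_cancel]; push_cast; ring)
  have := congrArg (fun f => f t) hlin
  simpa only [LinearMap.add_apply, LinearMap.sum_apply, LinearMap.smul_apply,
    LinearMap.comp_apply] using this

end Differential

section DifferentialAxiom

open CochainComplex.HomComplex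

variable {F : Type u} [Field F] {K : ECoalgebra F} {A : EAlgebra F} {r : ℕ}

/-- The derivation rule for the co-operations, for `ρ` of any degree. -/
theorem co_diff {q : ℕ} (ρ : E F r q) (a : ℤ) (c : K.cx.X a) :
    TPow.diff K.cx r (K.co a ρ c) =
      K.co a (bdry ρ) c + sgn F q • K.co (a + 1) ρ ((K.cx.d a (a + 1)).hom c) := by
  cases q with
  | zero =>
    refine (K.co_diff_zero ρ a c).trans ?_
    simp [bdry, sgn_zero]
  | succ q => exact K.co_diff_succ ρ a c

/-- The pairing commutes with the differentials. The terms in which `δ` acts on the tensor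
`ρ₂^*(c)` cancel those of `ρ₂^*(δ c)`, up to the boundary of `ρ₂`. -/
theorem pairing_diff {p q : ℕ} {d : Fin r → ℤ} {e : ℤ} (h : e + (p + q : ℕ) = ∑ i, d i)
    (ρ₁ : E F r p) (ρ₂ : E F r q) (z : ∀ i, Cochain K.cx A.cx (d i)) :
    δ e (e + 1) (pairing K A d e p q ρ₁ ρ₂ z) =
      pairing K A d (e + 1) (p - 1) q (bdry ρ₁) ρ₂ z +
      sgn F p • pairing K A d (e + 1) p (q - 1) ρ₁ (bdry ρ₂) z +
      ∑ i, sgn F ((p + q : ℕ) + ∑ j, if j < i then d j else 0) •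
        pairing K A (bump d i) (e + 1) p q ρ₁ ρ₂ fun j => slotCochain d i j (z j) := by
  refine cochain_hom_ext fun a b' hab' c => ?_
  obtain ⟨b, rfl⟩ : ∃ b, b' = b + 1 := ⟨b' - 1, by ring⟩
  have hab : a + e = b := by linarith
  have hab₂ : (a + 1) + e = b + 1 := by linarith
  have hsum_v : ∀ (f : Fin r → Cochain K.cx A.cx (e + 1)),
      ((∑ i, f i).v a (b + 1) hab').hom c = ∑ i, ((f i).v a (b + 1) hab').hom c := fun f => by
    induction (Finset.univ : Finset (Fin r)) using Finset.induction_on with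
    | empty => simp
    | insert i S hi ih => rw [Finset.sum_insert hi, Finset.sum_insert hi, add_v_hom, ih]
  have h₁ : ((pairing K A d (e + 1) (p - 1) q (bdry ρ₁) ρ₂ z).v a (b + 1) hab').hom c =
      sgn F (q * ∑ i, d i) • evalTensor K.cx A d (bdry ρ₁) (b + 1) z (K.co a ρ₂ c) := by
    cases p with
    | zero =>
      have : ∀ t, evalTensor K.cx A d (0 : E F r (0 - 1)) (b + 1) z t = 0 := fun t => by
        have := evalTensor_add (K := K.cx) d (0 : E F r (0 - 1)) 0 (b + 1) z
        rw [add_zero, left_eq_add] at this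
        rw [this, LinearMap.zero_apply]
      simp [bdry, this]
    | succ p => exact pairing_v (by rw [← h, Nat.add_sub_cancel]; push_cast; ring) _ _ _ _ _ _ _
  have h₂ : sgn F p • ((pairing K A d (e + 1) p (q - 1) ρ₁ (bdry ρ₂) z).v a (b + 1) hab').hom c =
      sgn F (q * ∑ i, d i + (p + ∑ i, d i)) •
        evalTensor K.cx A d ρ₁ (b + 1) z (K.co a (bdry ρ₂) c) := by
    cases q with
    | zero => simp [bdry]
    | succ q =>
      rw [pairing_v (by rw [← h, Nat.add_sub_cancel]; push_cast; ring), smul_smul, ← sgn_add]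
      congr 1
      refine sgn_eq_of_eq_add_two_mul F (-∑ i, d i) ?_
      rw [Nat.add_sub_cancel]
      push_cast
      ring
  have h₃ : ∀ i, ((pairing K A (bump d i) (e + 1) p q ρ₁ ρ₂
      fun j => slotCochain d i j (z j)).v a (b + 1) hab').hom c =
      sgn F (q * ∑ i, d i + q) • evalTensor K.cx A (bump d i) ρ₁ (b + 1)
        (fun j => slotCochain d i j (z j)) (K.co a ρ₂ c) := fun i => by
    rw [pairing_v (by rw [sum_bump, ← h]; ring), sum_bump, mul_add, mul_one]
  have hd := d_v (n := e) (m := e + 1) rfl rfl rfl (pairing K A d e p q ρ₁ ρ₂ z) hab hab' hab₂ c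
  rw [pairing_v h, pairing_v h, map_smul, evalTensor_diff, co_diff] at hd
  rw [add_v_hom, add_v_hom, smul_v_hom, hsum_v, h₁, h₂]
  simp only [smul_v_hom, h₃]
  rw [← sub_eq_iff_eq_add] at hd
  rw [← hd, smul_add, smul_add, map_add, map_smul, Finset.smul_sum]
  simp only [smul_add, smul_smul, ← sgn_add]
  have e₁ : sgn F (q * ∑ i, d i + (p + ∑ i, d i + q)) = sgn F (e + q * ∑ i, d i) := by
    refine sgn_eq_of_eq_add_two_mul F (p + q) ?_
    rw [← h]
    push_cast
    ring
  have e₂ : ∀ i, sgn F (q * ∑ i, d i + (p + ∑ j, if j < i then d j else 0)) =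
      sgn F ((p + q : ℕ) + (∑ j, if j < i then d j else 0) + (q * ∑ i, d i + q)) := fun i => by
    refine sgn_eq_of_eq_add_two_mul F (-q) ?_
    push_cast
    ring
  simp only [e₂]
  have e₁' : sgn F (q * ∑ i, d i + (p + ∑ i, d i) + q) = sgn F (e + q * ∑ i, d i) := by
    rw [← e₁]
    congr 1
    ring
  simp only [← add_assoc] at e₁ e₁' ⊢
  rw [e₁']
  abel

/-- The diagonal commutes with the differentials: the sum over the cuts of a chain of the boundary
of each of the two parts is the operation of the boundary of the chain. -/
theorem homOp_bd_chain {n : ℕ} {X : ℕ → Equiv.Perm (Fin r)} (hX : Reduced X (n + 1))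
    (d : Fin r → ℤ) (e : ℤ) (h : e + n = ∑ i, d i) (z : ∀ i, Cochain K.cx A.cx (d i)) :
    ∑ kl ∈ Finset.HasAntidiagonal.antidiagonal (n + 1),
      (pairing K A d e (kl.1 - 1) kl.2 (bdry (chain F X kl.1))
        (chain F (fun t => X (kl.1 + t)) kl.2) z +
      sgn F kl.1 • pairing K A d e kl.1 (kl.2 - 1) (chain F X kl.1)
        (bdry (chain F (fun t => X (kl.1 + t)) kl.2)) z) =
      homOp K A d e h (bd (chain F X (n + 1))) z := by
  rw [Finset.sum_add_distrib, Finset.Nat.sum_antidiagonal_succ, Finset.Nat.sum_antidiagonal_succ',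
    bd_chain hX]
  simp only [map_sum, map_smul, homOp_chain, _root_.sum_apply, _root_.smul_apply]
  simp only [Finset.smul_sum]
  rw [Finset.sum_comm]
  have hz₁ : bdry (chain F X 0) = 0 := rfl
  have hz₂ : bdry (chain F (fun t => X (n + 1 + t)) 0) = 0 := rfl
  rw [hz₁, hz₂, map_zero, map_zero, LinearMap.zero_apply]
  simp only [_root_.zero_apply, smul_zero, zero_add]
  rw [← Finset.sum_add_distrib]
  refine Finset.sum_congr rfl fun kl hkl => ?_
  obtain ⟨k, l⟩ := kl
  obtain rfl : k + l = n := Finset.HasAntidiagonal.mem_antidiagonal.1 hkl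
  have hb₁ : bdry (chain F X (k + 1)) = _ := bd_chain (hX.front (by omega))
  have hb₂ : bdry (chain F (fun t => X (k + t)) (l + 1)) = _ := bd_chain (hX.back (by omega))
  simp only [hb₁, hb₂]
  simp only [map_sum, map_smul, LinearMap.sum_apply, LinearMap.smul_apply, _root_.sum_apply,
    _root_.smul_apply, Finset.smul_sum]
  rw [Finset.sum_range_succ, Finset.sum_range_succ' _ (l + 1),
    show k + l + 2 = (k + 1) + (l + 1) by ring, Finset.sum_range_add _ (k + 1)]
  have c₁ : ∀ i ∈ Finset.range (k + 1),
      chain F (fun t => X (if k + t < i then k + t else k + t + 1)) l =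
        chain F (fun t => X (k + 1 + t)) l := fun i hi => chain_congr fun t _ => by
    have := Finset.mem_range.1 hi
    rw [if_neg (by omega)]
    congr 1
    omega
  have c₂ : ∀ j, chain F (fun t => X (if t < k + 1 + j then t else t + 1)) k = chain F X k :=
    fun j => chain_congr fun t ht => by rw [if_pos (by omega)]
  have c₃ : ∀ j, chain F (fun t => X (if k + t < k + 1 + j then k + t else k + t + 1)) l =
      chain F (fun t => X (k + if t < j + 1 then t else t + 1)) l :=
    fun j => chain_congr fun t _ => by
      congr 1
      split_ifs <;> omega
  have c₄ : chain F (fun t => X (k + if t < 0 then t else t + 1)) l =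
      chain F (fun t => X (k + 1 + t)) l := chain_congr fun t _ => by
    rw [if_neg (by omega)]
    congr 1
    omega
  have c₅ := c₂ 0
  rw [add_zero] at c₅
  rw [c₄, c₅]
  simp only [c₂, c₃]
  simp only [sgn_natCast, smul_smul, ← pow_add]
  have hcancel : ∀ x : Cochain K.cx A.cx e, (-1 : F) ^ (k + 1) • x + (-1 : F) ^ (k + 0) • x = 0 :=
    fun x => by rw [← add_smul, pow_succ, add_zero]; simp
  -- the last face of the front part and the first face of the back part cancel each other
  rw [add_add_add_comm]
  refine (congrArg (_ + ·) (hcancel _)).trans ((add_zero _).trans (congrArg₂ (· + ·) ?_ ?_))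
  · exact Finset.sum_congr rfl fun i hi => by rw [c₁ i hi]; rfl
  · exact Finset.sum_congr rfl fun j _ => by rw [add_right_comm, add_assoc]; rfl

theorem homOp_diff_zero (ρ : E F r 0) (d : Fin r → ℤ) (e : ℤ)
    (h : e + (0 : ℕ) = ∑ i, d i) (z : ∀ i, Cochain K.cx A.cx (d i)) :
    δ e (e + 1) (homOp K A d e h ρ z) =
      ∑ i, sgn F (∑ j, if j < i then d j else 0) •
        homOp K A (bump d i) (e + 1) (by rw [sum_bump, ← h]; ring) ρ
          fun j => slotCochain d i j (z j) := by
  induction ρ using chain_induction with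
  | zero => simp
  | add x y hx hy =>
    simp only [map_add, _root_.add_apply, δ_add, hx, hy, smul_add, Finset.sum_add_distrib]
  | smul k x hx =>
    simp only [map_smul, _root_.smul_apply, δ_smul, hx, Finset.smul_sum, smul_comm k]
  | reduced X hX =>
    simp only [homOp_chain, Finset.Nat.antidiagonal_zero, Finset.sum_singleton]
    rw [pairing_diff h]
    have : bdry (chain F X 0) = 0 := rfl
    have : bdry (chain F (fun t => X (0 + t)) 0) = 0 := rfl
    simp [*]

theorem homOp_diff_succ {n : ℕ} (ρ : E F r (n + 1)) (d : Fin r → ℤ) (e : ℤ)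
    (h : e + (n + 1 : ℕ) = ∑ i, d i) (z : ∀ i, Cochain K.cx A.cx (d i)) :
    δ e (e + 1) (homOp K A d e h ρ z) =
      homOp K A d (e + 1) (by rw [← h]; push_cast; ring) (bd ρ) z +
      ∑ i, sgn F ((n + 1 : ℕ) + ∑ j, if j < i then d j else 0) •
        homOp K A (bump d i) (e + 1) (by rw [sum_bump, ← h]; ring) ρ
          fun j => slotCochain d i j (z j) := by
  induction ρ using chain_induction with
  | zero => simp
  | add x y hx hy =>
    simp only [map_add, _root_.add_apply, δ_add, hx, hy, smul_add, Finset.sum_add_distrib]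
    abel
  | smul k x hx =>
    simp only [map_smul, _root_.smul_apply, δ_smul, hx, Finset.smul_sum, smul_comm k, smul_add]
  | reduced X hX =>
    rw [← homOp_bd_chain hX]
    simp only [homOp_chain, _root_.sum_apply, Finset.smul_sum]
    have hδ : ∀ (S : Finset (ℕ × ℕ)) (f : ℕ × ℕ → Cochain K.cx A.cx e),
        δ e (e + 1) (∑ kl ∈ S, f kl) = ∑ kl ∈ S, δ e (e + 1) (f kl) := fun S f =>
      map_sum (δ_hom F K.cx A.cx e (e + 1)) f S
    rw [hδ, Finset.sum_comm, ← Finset.sum_add_distrib]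
    refine Finset.sum_congr rfl fun kl hkl => ?_
    rw [Finset.HasAntidiagonal.mem_antidiagonal] at hkl
    rw [pairing_diff (by rw [hkl, h]), hkl]

/-- The dg-module `Hom_F(K, A)` is an `E`-algebra. -/
theorem homData_isEAlgebra (K : ECoalgebra F) (A : EAlgebra F) : (homData K A).IsEAlgebra where
  op_one e h z := homOp_one e h z
  op_comp ρ σ d d' e h h' h'' u := homOp_comp ρ σ d d' e h h' h'' u
  op_act w ρ d e h z := homOp_act w ρ d e h z
  op_diff_zero ρ d e h z := homOp_diff_zero ρ d e h z
  op_diff_succ ρ d e h z := homOp_diff_succ ρ d e h z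

end DifferentialAxiom

/-! ### The left adjoint of `Hom_F(K, -)` -/

section Division

open CochainComplex.HomComplex

variable {F : Type u} [Field F]

/-- Formal expressions for the elements of degree `n` of `A ⊘ K`: they are built from the
generators `a ⊗ c` (thought of as the value at `c` of the universal homogeneous morphism attached
to `a`) with the operations of an `E`-algebra. -/
inductive DivTerm (K : ECoalgebra F) (A : EAlgebra F) : ℤ → Type u
  | gen {i p n : ℤ} (h : p + i = n) (a : A.cx.X i) (c : K.cx.X p) : DivTerm K A n
  | zero (n : ℤ) : DivTerm K A n
  | add {n : ℤ} (s t : DivTerm K A n) : DivTerm K A n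
  | smul {n : ℤ} (k : F) (t : DivTerm K A n) : DivTerm K A n
  | diff {n : ℤ} (m : ℤ) (t : DivTerm K A n) : DivTerm K A m
  | op {r n : ℕ} (d : Fin r → ℤ) (e : ℤ) (h : e + n = ∑ i, d i) (ρ : E F r n)
      (t : ∀ i, DivTerm K A (d i)) : DivTerm K A e

variable (K : ECoalgebra F) (hK : ∀ A : EAlgebra F, (homData K A).IsEAlgebra) (A : EAlgebra F)

/-- The value of a formal expression in an `E`-algebra `B`, with respect to a morphism
`φ : A ⟶ Hom_F(K, B)`. -/
def DivTerm.eval {B : EAlgebra F} (φ : A ⟶ (homFunctor K hK).obj B) :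
    ∀ {n : ℤ}, DivTerm K A n → B.cx.X n
  | _, .gen h a c => (Cochain.v ((φ.hom.f _).hom a : Cochain K.cx B.cx _) _ _ h).hom c
  | _, .zero _ => 0
  | _, .add s t => s.eval φ + t.eval φ
  | _, .smul k t => k • t.eval φ
  | _, .diff m t => (B.cx.d _ m).hom (t.eval φ)
  | _, .op d e h ρ t => B.op d e h ρ fun i => (t i).eval φ

/-- Two formal expressions are identified when they have the same value in every `E`-algebra `B`
under every morphism `A ⟶ Hom_F(K, B)`. -/
def divSetoid (n : ℤ) : Setoid (DivTerm K A n) where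
  r s t := ∀ (B : EAlgebra F) (φ : A ⟶ (homFunctor K hK).obj B), s.eval K hK A φ = t.eval K hK A φ
  iseqv := ⟨fun _ _ _ => rfl, fun h B φ => (h B φ).symm, fun h h' B φ => (h B φ).trans (h' B φ)⟩

/-- The elements of degree `n` of `A ⊘ K`. -/
def DivElem (n : ℤ) : Type u := Quotient (divSetoid K hK A n)

namespace DivElem

variable {K hK A}

/-- The value of an element of `A ⊘ K` in an `E`-algebra `B`. -/
def ev {B : EAlgebra F} (φ : A ⟶ (homFunctor K hK).obj B) {n : ℤ} (t : DivElem K hK A n) :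
    B.cx.X n :=
  Quotient.lift (fun t => t.eval K hK A φ)
    (fun s t h => (show ∀ (B : EAlgebra F) (φ : A ⟶ (homFunctor K hK).obj B),
      s.eval K hK A φ = t.eval K hK A φ from h) B φ) t

/-- The class of a formal expression. -/
def mk {n : ℤ} (t : DivTerm K A n) : DivElem K hK A n := Quotient.mk (divSetoid K hK A n) t

/-- A formal expression which represents an element. -/
def rep {n : ℤ} (t : DivElem K hK A n) : DivTerm K A n := Quotient.out t

theorem ev_mk {B : EAlgebra F} (φ : A ⟶ (homFunctor K hK).obj B) {n : ℤ} (t : DivTerm K A n) :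
    ev φ (mk t) = t.eval K hK A φ := rfl

theorem eval_rep {B : EAlgebra F} (φ : A ⟶ (homFunctor K hK).obj B) {n : ℤ}
    (t : DivElem K hK A n) : t.rep.eval K hK A φ = ev φ t := by
  conv_rhs => rw [← Quotient.out_eq t]
  rfl

/-- Elements of `A ⊘ K` are detected by their values. -/
theorem ext_ev {n : ℤ} {s t : DivElem K hK A n}
    (h : ∀ (B : EAlgebra F) (φ : A ⟶ (homFunctor K hK).obj B), ev φ s = ev φ t) : s = t := by
  induction s using Quotient.inductionOn
  induction t using Quotient.inductionOn
  exact Quotient.sound h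

instance (n : ℤ) : Zero (DivElem K hK A n) := ⟨mk (.zero n)⟩
instance (n : ℤ) : Add (DivElem K hK A n) := ⟨fun s t => mk (.add s.rep t.rep)⟩
instance (n : ℤ) : SMul F (DivElem K hK A n) := ⟨fun k t => mk (.smul k t.rep)⟩
instance (n : ℤ) : Neg (DivElem K hK A n) := ⟨fun t => (-1 : F) • t⟩

section

variable {B : EAlgebra F} (φ : A ⟶ (homFunctor K hK).obj B) {n : ℤ}

theorem ev_zero : ev φ (0 : DivElem K hK A n) = 0 := rfl

theorem ev_add (s t : DivElem K hK A n) : ev φ (s + t) = ev φ s + ev φ t := by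
  rw [← eval_rep φ s, ← eval_rep φ t]
  rfl

theorem ev_smul (k : F) (t : DivElem K hK A n) : ev φ (k • t) = k • ev φ t := by
  rw [← eval_rep φ t]
  rfl

theorem ev_neg (t : DivElem K hK A n) : ev φ (-t) = -ev φ t :=
  (ev_smul φ (-1) t).trans (neg_one_smul F _)

end

instance (n : ℤ) : AddCommGroup (DivElem K hK A n) :=
  { AddGroup.ofLeftAxioms (G := DivElem K hK A n)
      (fun a b c => ext_ev fun B φ => by simp only [ev_add, add_assoc])
      (fun a => ext_ev fun B φ => by rw [ev_add, ev_zero, zero_add])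
      (fun a => ext_ev fun B φ => by rw [ev_add, ev_neg, ev_zero, neg_add_cancel]) with
    add_comm := fun a b => ext_ev fun B φ => by rw [ev_add, ev_add, add_comm] }

instance (n : ℤ) : Module F (DivElem K hK A n) where
  one_smul t := ext_ev fun B φ => by rw [ev_smul, one_smul]
  mul_smul a b t := ext_ev fun B φ => by simp only [ev_smul, mul_smul]
  smul_zero a := ext_ev fun B φ => by rw [ev_smul, ev_zero, smul_zero]
  smul_add a s t := ext_ev fun B φ => by simp only [ev_smul, ev_add, smul_add]
  add_smul a b t := ext_ev fun B φ => by simp only [ev_smul, ev_add, add_smul]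
  zero_smul t := ext_ev fun B φ => by rw [ev_smul, ev_zero, zero_smul]

/-- The value of an element, as a linear map. -/
def evLin {B : EAlgebra F} (φ : A ⟶ (homFunctor K hK).obj B) (n : ℤ) :
    DivElem K hK A n →ₗ[F] B.cx.X n where
  toFun := ev φ
  map_add' := ev_add φ
  map_smul' := ev_smul φ

/-- The differential of `A ⊘ K`. -/
def diff (n m : ℤ) : DivElem K hK A n →ₗ[F] DivElem K hK A m where
  toFun t := mk (.diff m t.rep)
  map_add' s t := ext_ev fun B φ => by
    rw [ev_add]
    simp only [ev_mk, DivTerm.eval, eval_rep, ev_add, map_add]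
  map_smul' k t := ext_ev fun B φ => by
    rw [ev_smul]
    simp only [ev_mk, DivTerm.eval, eval_rep, ev_smul, map_smul, RingHom.id_apply]

theorem ev_diff {B : EAlgebra F} (φ : A ⟶ (homFunctor K hK).obj B) {n : ℤ} (m : ℤ)
    (t : DivElem K hK A n) : ev φ (diff n m t) = (B.cx.d n m).hom (ev φ t) := by
  rw [← eval_rep φ t]
  rfl

/-- The operations of `A ⊘ K`, as functions. -/
def op {r n : ℕ} (d : Fin r → ℤ) (e : ℤ) (h : e + n = ∑ i, d i) (ρ : E F r n)
    (t : ∀ i, DivElem K hK A (d i)) : DivElem K hK A e :=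
  mk (.op d e h ρ fun i => (t i).rep)

theorem ev_op {B : EAlgebra F} (φ : A ⟶ (homFunctor K hK).obj B) {r n : ℕ} (d : Fin r → ℤ)
    (e : ℤ) (h : e + n = ∑ i, d i) (ρ : E F r n) (t : ∀ i, DivElem K hK A (d i)) :
    ev φ (op d e h ρ t) = B.op d e h ρ fun i => ev φ (t i) := by
  simp only [← eval_rep φ]
  exact eval_rep φ _

theorem ev_update {B : EAlgebra F} (φ : A ⟶ (homFunctor K hK).obj B) {r : ℕ} (d : Fin r → ℤ)
    [DecidableEq (Fin r)] (t : ∀ i, DivElem K hK A (d i)) (i : Fin r) (x : DivElem K hK A (d i)) :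
    (fun j => ev φ (Function.update t i x j)) = Function.update (fun j => ev φ (t j)) i (ev φ x) := by
  funext j
  exact Function.apply_update (fun j => ev φ) t i x j

end DivElem

/-- The dg-module `A ⊘ K`. -/
def divComplex : DG F where
  X n := ModuleCat.of F (DivElem K hK A n)
  d n m := ModuleCat.ofHom (DivElem.diff n m)
  shape n m h := by
    apply ModuleCat.hom_ext
    apply LinearMap.ext
    intro t
    refine DivElem.ext_ev fun B φ => (DivElem.ev_diff φ m t).trans ?_
    rw [B.cx.shape n m h]
    rfl
  d_comp_d' i j k _ _ := by
    apply ModuleCat.hom_ext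
    apply LinearMap.ext
    intro t
    refine DivElem.ext_ev fun B φ => (DivElem.ev_diff φ k _).trans ?_
    refine (congrArg _ (DivElem.ev_diff φ j t)).trans ?_
    rw [← ModuleCat.comp_apply, B.cx.d_comp_d]
    rfl

/-- The dg-module `A ⊘ K` with its operations. -/
abbrev divData : EAlgebraData F where
  cx := divComplex K hK A
  op {r n} d e h :=
    { toFun := fun ρ =>
        { toFun := fun t => DivElem.op d e h ρ t
          map_update_add' := fun t i x y => DivElem.ext_ev fun B φ => by
            refine (DivElem.ev_op φ d e h ρ _).trans (Eq.trans ?_ (DivElem.ev_add φ _ _).symm)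
            erw [DivElem.ev_op, DivElem.ev_op, DivElem.ev_update, DivElem.ev_update,
              DivElem.ev_update, DivElem.ev_add, MultilinearMap.map_update_add]
          map_update_smul' := fun t i k x => DivElem.ext_ev fun B φ => by
            refine (DivElem.ev_op φ d e h ρ _).trans (Eq.trans ?_ (DivElem.ev_smul φ _ _).symm)
            erw [DivElem.ev_op, DivElem.ev_update, DivElem.ev_update, DivElem.ev_smul,
              MultilinearMap.map_update_smul] }
      map_add' := fun ρ σ => MultilinearMap.ext fun t => DivElem.ext_ev fun B φ => by
        refine (DivElem.ev_op φ d e h _ t).trans (Eq.trans ?_ (DivElem.ev_add φ _ _).symm)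
        erw [DivElem.ev_op, DivElem.ev_op, map_add]
        rfl
      map_smul' := fun k ρ => MultilinearMap.ext fun t => DivElem.ext_ev fun B φ => by
        refine (DivElem.ev_op φ d e h _ t).trans (Eq.trans ?_ (DivElem.ev_smul φ _ _).symm)
        erw [DivElem.ev_op, map_smul]
        rfl }

/-- The value of elements of `A ⊘ K` in `B`, as a morphism of dg-modules. -/
def divEv {B : EAlgebra F} (φ : A ⟶ (homFunctor K hK).obj B) : divComplex K hK A ⟶ B.cx where
  f n := ModuleCat.ofHom (DivElem.evLin φ n)
  comm' n m _ := by
    apply ModuleCat.hom_ext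
    apply LinearMap.ext
    intro t
    exact (DivElem.ev_diff φ m t).symm

theorem divEv_op {B : EAlgebra F} (φ : A ⟶ (homFunctor K hK).obj B) {r n : ℕ} (d : Fin r → ℤ)
    (e : ℤ) (h : e + n = ∑ i, d i) (ρ : E F r n) (t : ∀ i, (divComplex K hK A).X (d i)) :
    (divEv K hK A φ).f e ((divData K hK A).op d e h ρ t) =
      B.op d e h ρ fun i => (divEv K hK A φ).f (d i) (t i) :=
  DivElem.ev_op φ d e h ρ t

variable {K hK A} in
theorem divComplex_ext {n : ℤ} {s t : (divComplex K hK A).X n}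
    (h : ∀ (B : EAlgebra F) (φ : A ⟶ (homFunctor K hK).obj B),
      (divEv K hK A φ).f n s = (divEv K hK A φ).f n t) : s = t :=
  DivElem.ext_ev h

theorem slot_map {V W : DG F} (f : V ⟶ W) {r : ℕ} (d : Fin r → ℤ) (i j : Fin r) (x : V.X (d j)) :
    f.f (bump d i j) (slot V d i j x) = slot W d i j (f.f (d j) x) := by
  unfold slot
  split_ifs with h
  · have := f.comm (d j) (bump d i j)
    exact (congrArg (fun g => g.hom x) this).symm
  · have aux : ∀ {a b : ℤ} (h : a = b) (x : V.X a),
        f.f b ((V.XIsoOfEq h).hom x) = (W.XIsoOfEq h).hom (f.f a x) := by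
      rintro a _ rfl x
      simp
    exact aux _ x

theorem divData_isEAlgebra : (divData K hK A).IsEAlgebra where
  op_one e h a := divComplex_ext fun B φ => by
    rw [divEv_op, B.isEAlgebra.op_one]
  op_comp ρ σ d d' e h h' h'' a := divComplex_ext fun B φ => by
    rw [divEv_op, B.isEAlgebra.op_comp ρ σ d d' e h h' h'', map_smul, divEv_op]
    congr 2
    funext i
    exact (divEv_op K hK A φ _ _ (h' i) (σ i) _).symm
  op_act w ρ d e h a := divComplex_ext fun B φ => by
    rw [divEv_op, B.isEAlgebra.op_act, map_smul, divEv_op]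
  op_diff_zero ρ d e h a := divComplex_ext fun B φ => by
    have := congrArg (fun g => g.hom ((divData K hK A).op d e h ρ a))
      ((divEv K hK A φ).comm e (e + 1))
    refine this.symm.trans ?_
    rw [ModuleCat.hom_comp, LinearMap.comp_apply, divEv_op, B.isEAlgebra.op_diff_zero]
    rw [map_sum]
    exact Finset.sum_congr rfl fun i _ => by
      rw [map_smul, divEv_op]; simp only [slot_map]
  op_diff_succ ρ d e h a := divComplex_ext fun B φ => by
    have := congrArg (fun g => g.hom ((divData K hK A).op d e h ρ a))
      ((divEv K hK A φ).comm e (e + 1))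
    refine this.symm.trans ?_
    rw [ModuleCat.hom_comp, LinearMap.comp_apply, divEv_op, B.isEAlgebra.op_diff_succ]
    rw [map_add, divEv_op, map_sum]
    congr 1
    exact Finset.sum_congr rfl fun i _ => by
      rw [map_smul, divEv_op]; simp only [slot_map]

/-- The `E`-algebra `A ⊘ K`. -/
abbrev divAlgebra : EAlgebra F := { divData K hK A with isEAlgebra := divData_isEAlgebra K hK A }

/-- The morphism `A ⊘ K ⟶ B` attached to `φ : A ⟶ Hom_F(K, B)`. -/
def divLift {B : EAlgebra F} (φ : A ⟶ (homFunctor K hK).obj B) : divAlgebra K hK A ⟶ B where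
  hom := divEv K hK A φ
  map_op d e h ρ a := divEv_op K hK A φ d e h ρ a

theorem gen_ev {i p n : ℤ} (h : p + i = n) (a : A.cx.X i) (c : K.cx.X p) {B : EAlgebra F}
    (φ : A ⟶ (homFunctor K hK).obj B) :
    DivElem.ev φ (.mk (.gen h a c) : DivElem K hK A n) =
      (Cochain.v ((φ.hom.f i).hom a : Cochain K.cx B.cx i) p n h).hom c := rfl

/-- The universal homogeneous morphism `c ↦ a ⊗ c` attached to `a`. -/
def divGen (i : ℤ) : A.cx.X i →ₗ[F] Cochain K.cx (divComplex K hK A) i where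
  toFun a := Cochain.mk fun p n h => ModuleCat.ofHom
    { toFun := fun c => (.mk (.gen h a c) : DivElem K hK A n)
      map_add' := fun c c' => DivElem.ext_ev fun B φ => by
        rw [DivElem.ev_add, gen_ev, gen_ev, gen_ev, map_add]
      map_smul' := fun k c => DivElem.ext_ev fun B φ => by
        rw [DivElem.ev_smul, gen_ev, gen_ev, map_smul, RingHom.id_apply] }
  map_add' a a' := by
    ext p n h c
    refine DivElem.ext_ev fun B φ => Eq.trans ?_ (DivElem.ev_add φ _ _).symm
    erw [gen_ev, gen_ev, gen_ev, map_add]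
    rfl
  map_smul' k a := by
    ext p n h c
    refine DivElem.ext_ev fun B φ => Eq.trans ?_ (DivElem.ev_smul φ _ _).symm
    erw [gen_ev, gen_ev, map_smul]
    rfl

theorem divGen_ev {i : ℤ} (a : A.cx.X i) {B : EAlgebra F} (φ : A ⟶ (homFunctor K hK).obj B) :
    (divGen K hK A i a).comp (Cochain.ofHom (divEv K hK A φ)) (add_zero i) =
      (φ.hom.f i).hom a := by
  ext p q h c
  rw [Cochain.comp_zero_cochain_v, Cochain.ofHom_v]
  rfl

variable {K hK A} in
/-- Homogeneous morphisms into `A ⊘ K` are detected by their composites with the values. -/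
theorem cochain_ext {i : ℤ} {y z : Cochain K.cx (divComplex K hK A) i}
    (h : ∀ (B : EAlgebra F) (φ : A ⟶ (homFunctor K hK).obj B),
      y.comp (Cochain.ofHom (divEv K hK A φ)) (add_zero i) =
        z.comp (Cochain.ofHom (divEv K hK A φ)) (add_zero i)) : y = z := by
  ext p q hpq c
  refine divComplex_ext fun B φ => ?_
  have := congrArg (fun w : Cochain K.cx B.cx i => (w.v p q hpq).hom c) (h B φ)
  rw [Cochain.comp_zero_cochain_v, Cochain.comp_zero_cochain_v, Cochain.ofHom_v] at this
  exact this

/-- The unit `A ⟶ Hom_F(K, A ⊘ K)`. -/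
def divUnit : A ⟶ (homFunctor K hK).obj (divAlgebra K hK A) where
  hom :=
    { f := fun i => ModuleCat.ofHom (divGen K hK A i)
      comm' := fun i j _ => by
        apply ModuleCat.hom_ext
        apply LinearMap.ext
        intro a
        refine cochain_ext (i := j) fun B φ => ?_
        refine (δ_comp_ofHom (divGen K hK A i a) (divEv K hK A φ) j).symm.trans ?_
        refine Eq.trans ?_ (divGen_ev K hK A _ φ).symm
        rw [divGen_ev]
        exact congrArg (fun g => g.hom a) (φ.hom.comm i j) }
  map_op d e h ρ a := by
    refine cochain_ext (i := e) fun B φ => ?_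
    refine (divGen_ev K hK A _ φ).trans ?_
    refine Eq.trans ?_ (homMap_op K (divLift K hK A φ) d e h ρ _).symm
    refine (φ.map_op d e h ρ a).trans ?_
    change homOp K B d e h ρ _ = homOp K B d e h ρ _
    congr 1
    funext i
    exact (divGen_ev K hK A (a i) φ).symm

/-- A morphism `f : A ⊘ K ⟶ B` is the value under the morphism `A ⟶ Hom_F(K, B)` attached to it. -/
theorem eval_comp {B : EAlgebra F} (f : divAlgebra K hK A ⟶ B) {n : ℤ} (t : DivTerm K A n) :
    t.eval K hK A (divUnit K hK A ≫ (homFunctor K hK).map f) =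
      f.hom.f n (DivElem.mk t : DivElem K hK A n) := by
  have mk_eq : ∀ {n : ℤ} (t : DivTerm K A n) (s : DivElem K hK A n),
      (∀ (B : EAlgebra F) (φ : A ⟶ (homFunctor K hK).obj B), t.eval K hK A φ = s.ev φ) →
        (DivElem.mk t : DivElem K hK A n) = s := fun t s h => DivElem.ext_ev h
  induction t with
  | gen h a c =>
    change (Cochain.v ((divGen K hK A _ a).comp (Cochain.ofHom f.hom) (add_zero _)) _ _ h).hom c = _
    rw [Cochain.comp_zero_cochain_v]
    erw [Cochain.ofHom_v]
    rfl
  | zero n => exact (map_zero (f.hom.f n).hom).symm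
  | add s t hs ht =>
    rw [mk_eq (.add s t) (.mk s + .mk t) fun B φ => by rw [DivElem.ev_add]; rfl]
    exact (congrArg₂ (· + ·) hs ht).trans (map_add (f.hom.f _).hom _ _).symm
  | smul k t ht =>
    rw [mk_eq (.smul k t) (k • .mk t) fun B φ => by rw [DivElem.ev_smul]; rfl]
    exact (congrArg (k • ·) ht).trans (map_smul (f.hom.f _).hom _ _).symm
  | @diff n m t ht =>
    rw [mk_eq (.diff m t) (DivElem.diff n m (.mk t)) fun B φ => by rw [DivElem.ev_diff]; rfl]
    exact (congrArg _ ht).trans (congrArg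
      (fun g : (divAlgebra K hK A).cx.X n ⟶ B.cx.X m => g.hom (.mk t : DivElem K hK A n))
      (f.hom.comm n m))
  | op d e h ρ t ht =>
    rw [mk_eq (.op d e h ρ t) (DivElem.op d e h ρ fun i => .mk (t i))
      fun B φ => by rw [DivElem.ev_op]; rfl]
    refine Eq.trans ?_ (f.map_op d e h ρ fun i => (.mk (t i) : DivElem K hK A (d i))).symm
    simp only [DivTerm.eval, ht]

/-- The universal property of `A ⊘ K`. -/
def divEquiv (B : EAlgebra F) :
    (divAlgebra K hK A ⟶ B) ≃ (A ⟶ (homFunctor K hK).obj B) where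
  toFun f := divUnit K hK A ≫ (homFunctor K hK).map f
  invFun φ := divLift K hK A φ
  left_inv f := by
    apply EAlgebra.Hom.ext
    ext n t
    obtain ⟨t, rfl⟩ : ∃ s, t = (DivElem.mk s : DivElem K hK A n) :=
      ⟨DivElem.rep t, (Quotient.out_eq t).symm⟩
    exact eval_comp K hK A f t
  right_inv φ := by
    apply EAlgebra.Hom.ext
    ext i a
    exact divGen_ev K hK A a φ

/-- The functor `A ↦ A ⊘ K`. -/
def divFunctor : EAlgebra F ⥤ EAlgebra F :=
  Adjunction.leftAdjointOfEquiv (G := homFunctor K hK) (F_obj := divAlgebra K hK)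
    (fun A B => divEquiv K hK A B) fun A B B' g f => by
      simp only [divEquiv, Equiv.coe_fn_mk, Functor.map_comp, Category.assoc]

/-- The functor `- ⊘ K` is left adjoint to `Hom_F(K, -)`. -/
def divAdjunction : divFunctor K hK ⊣ homFunctor K hK :=
  Adjunction.adjunctionOfEquivLeft _ _

end Division

end BarrattEccles

end

theorem proposition1p6 (F : Type u) [Field F] (K : BarrattEccles.ECoalgebra F) :
    ∃ hK : ∀ A : BarrattEccles.EAlgebra F, (BarrattEccles.homData K A).IsEAlgebra,
      ∃ division : BarrattEccles.EAlgebra F ⥤ BarrattEccles.EAlgebra F,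
        Nonempty (division ⊣ BarrattEccles.homFunctor K hK) ∧
          ∀ A : BarrattEccles.EAlgebra F,
            Nonempty (coyoneda.obj (Opposite.op (division.obj A)) ≅
              BarrattEccles.homFunctor K hK ⋙ coyoneda.obj (Opposite.op A)) :=
  let hK := BarrattEccles.homData_isEAlgebra K
  let adj := BarrattEccles.divAdjunction K hK
  ⟨hK, BarrattEccles.divFunctor K hK, ⟨adj⟩, fun A => ⟨(adj.corepresentableBy A).toIso⟩⟩
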